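/- Let $k\in\mathbb N$. A $k$-partite (unnormalised) pure state is a vector $|\phi\rangle\in\mathcal H_1\otimes\cdots\otimes\mathcal H_k$ with finite-dimensional complex Hilbert spaces $\mathcal H_j$. Call $|\phi\rangle\in\bigotimes_j\mathcal H_j$ and $|\psi\rangle\in\bigotimes_j\mathcal H'_j$ locally unitarily equivalent if there are partial isometries $U_j:\mathcal H_j\to\mathcal H_j'$ with $|\psi\rangle=(U_1\otimes\cdots\otimes U_k)|\phi\rangle$ and $|\phi\rangle=(U_1^*\otimes\cdots\otimes U_k^*)|\psi\rangle$. Let $\mathcal S_k$ be the commutative semiring of equivalence classes, with addition induced by the direct sum $|\psi\rangle\oplus|\phi\rangle\in\bigotimes_j(\mathcal H_j\oplus\mathcal H_j')$, multiplication induced by the tensor product $|\psi\rangle\otimes|\phi\rangle\in\bigotimes_j(\mathcal H_j\otimes\mathcal H_j')$, zero the class of the vector $0$, and unit the class of $|0\ldots0\rangle\in\mathbb C\otimes\cdots\otimes\mathbb C$. A one-step LOCC channel is a map $\Lambda$ from $\mathcal B(\mathcal H_1)\otimes\cdots\otimes\mathcal B(\mathcal H_k)\otimes\mathrm{Diag}(\mathbb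 C^{\mathcal X})$ to the same space with $\mathcal H_i$ replaced by $\mathcal H'_i$ for one party $i$ and $\mathcal X$ replaced by $\mathcal Y$ ($\mathcal X,\mathcal Y$ finite sets), of the form $$\Lambda(\rho)=\sum_{j\in J}\big((K_j)_i\otimes|g(j)\rangle\langle f(j)|\big)\,\rho\,\big((K_j^*)_i\otimes|f(j)\rangle\langle g(j)|\big),$$ where $J$ is a finite set, $f:J\to\mathcal X$ and $g:J\to\mathcal Y$ are maps, and $K_j:\mathcal H_i\to\mathcal H'_i$ are linear maps with $\sum_{j}K_j^*K_j\otimes|f(j)\rangle\langle f(j)|\le I$; here $(K)_i$ denotes $K$ acting on the $i$-th tensor factor and the identity on the others. An LOCC channel is a finite composition of one-step LOCC channels. Write $|\psi\rangle\xrightarrow{\mathrm{LOCC}}|\phi\rangle$ if some LOCC channel (with one-point registers at both ends) maps $|\psi\rangle\langle\psi|$ to $|\phi\rangle\langle\phi|$. Theorem. Let $f:\mathcal S_k\to\mathbb R^+=[0,\infty)$ be a semiring homomorphism. Then $f$ is LOCC-monotone, i.e. $f(|\psi\rangle)\ge f(|\phi\rangle)$ whenever $|\psi\rangle\xrightarrow{\mathrm{LOCC}}|\phi\rangle$,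 if and only if there is an $\alpha\in[0,1]$ such that $f(\sqrt p\,|0\ldots0\rangle)=p^\alpha$ for all $p>0$ and $$f(|\phi\rangle)\ \ge\ \Big(f\big((\Pi)_i|\phi\rangle\big)^{1/\alpha}+f\big((I-\Pi)_i|\phi\rangle\big)^{1/\alpha}\Big)^{\alpha}$$ for all finite-dimensional Hilbert spaces $\mathcal H_1,\dots,\mathcal H_k$, all $|\phi\rangle\in\mathcal H_1\otimes\cdots\otimes\mathcal H_k$, all $i\in\{1,\dots,k\}$ and all orthogonal projections $\Pi\in\mathcal B(\mathcal H_i)$. For $\alpha=0$ the right-hand side means its limit $\max\{f((\Pi)_i|\phi\rangle),\,f((I-\Pi)_i|\phi\rangle)\}$. -/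

import Mathlib

open scoped NNReal Matrix

namespace LOCC

/-! ## Pure states of `k` parties

The local Hilbert space of party `j` is `ℂ^(d j)` with its standard orthonormal basis; the tensor
product of the local spaces has the basis `Idx d` of all tuples of local basis labels. -/

/-- Labels of the product basis of `ℂ^(d 1) ⊗ ⋯ ⊗ ℂ^(d k)`. -/
abbrev Idx {k : ℕ} (d : Fin k → ℕ) : Type := (j : Fin k) → Fin (d j)

/-- Vectors of `ℂ^(d 1) ⊗ ⋯ ⊗ ℂ^(d k)`: unnormalised pure states. -/
abbrev PureState {k : ℕ} (d : Fin k → ℕ) : Type := Idx d → ℂ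

/-- The tensor product `U 1 ⊗ ⋯ ⊗ U k` of local linear maps. -/
def tensorOp {k : ℕ} {d d' : Fin k → ℕ} (U : (j : Fin k) → Matrix (Fin (d' j)) (Fin (d j)) ℂ) :
    Matrix (Idx d') (Idx d) ℂ :=
  Matrix.of fun y x => ∏ j, U j (y j) (x j)

/-- `I ⊗ ⋯ ⊗ K ⊗ ⋯ ⊗ I` with `K` in position `i`; used only when `d' j = d j` for all `j ≠ i`. -/
def localOp {k : ℕ} {d d' : Fin k → ℕ} (i : Fin k) (K : Matrix (Fin (d' i)) (Fin (d i)) ℂ) :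
    Matrix (Idx d') (Idx d) ℂ :=
  Matrix.of fun y x => if ∀ j, j ≠ i → (y j : ℕ) = (x j : ℕ) then K (y i) (x i) else 0

/-- The rank one operator `|ψ⟩⟨ψ|`. -/
def ketbra {k : ℕ} {d : Fin k → ℕ} (ψ : PureState d) : Matrix (Idx d) (Idx d) ℂ :=
  Matrix.vecMulVec ψ (star ψ)

/-! ## LOCC channels -/

/-- `B(ℂ^(d 1)) ⊗ ⋯ ⊗ B(ℂ^(d k)) ⊗ Diag(ℂ^X)`: the element `∑ x, ρ x ⊗ |x⟩⟨x|` is written as the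
family `ρ` of its diagonal blocks. -/
abbrev RegOp {k : ℕ} (d : Fin k → ℕ) (X : Type) : Type := X → Matrix (Idx d) (Idx d) ℂ

open scoped ComplexOrder in
/-- The data of a one-step LOCC channel. -/
structure OneStep {k : ℕ} (d d' : Fin k → ℕ) (X Y : Type) where
  /-- the party that acts -/
  i : Fin k
  /-- the spaces of the other parties do not change -/
  dims_eq : ∀ j, j ≠ i → d' j = d j
  /-- the index set of the Kraus operators -/
  J : Type
  [fintypeJ : Fintype J]
  /-- the value of the register that is read -/
  f : J → X
  /-- the value of the register that is written -/
  g : J → Y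
  /-- the Kraus operators -/
  K : J → Matrix (Fin (d' i)) (Fin (d i)) ℂ
  /-- `∑ j, (K j)* (K j) ⊗ |f j⟩⟨f j| ≤ I`, block by block -/
  kraus_le : open Classical in
    ∀ x : X, (1 - ∑ j with f j = x, (K j)ᴴ * K j).PosSemidef

attribute [instance] OneStep.fintypeJ

open Classical in
/-- `ρ ↦ ∑ j, ((K j)_i ⊗ |g j⟩⟨f j|) ρ ((K j)*_i ⊗ |f j⟩⟨g j|)`; its block at `y` collects the terms
with `g j = y`. -/
noncomputable def OneStep.apply {k : ℕ} {d d' : Fin k → ℕ} {X Y : Type} (c : OneStep d d' X Y)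
    (ρ : RegOp d X) : RegOp d' Y := fun y =>
  ∑ j with c.g j = y,
    (localOp c.i (c.K j) : Matrix (Idx d') (Idx d) ℂ) * ρ (c.f j) *
      (localOp c.i (c.K j) : Matrix (Idx d') (Idx d) ℂ)ᴴ

/-- LOCC channels: finite compositions of one-step LOCC channels, with finite registers. -/
inductive IsLOCC {k : ℕ} : {d d' : Fin k → ℕ} → {X Y : Type} → (RegOp d X → RegOp d' Y) → Prop
  | id {d : Fin k → ℕ} {X : Type} [Finite X] : IsLOCC (id : RegOp d X → RegOp d X)
  | step {d d' d'' : Fin k → ℕ} {X Y Z : Type} [Finite X] [Finite Y] [Finite Z]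
      {Λ : RegOp d X → RegOp d' Y} (hΛ : IsLOCC Λ) (c : OneStep d' d'' Y Z) :
      IsLOCC (fun ρ => c.apply (Λ ρ))

/-- `ψ ⟶ φ` under LOCC: some LOCC channel maps `|ψ⟩⟨ψ|` to `|φ⟩⟨φ|`. States without register are
states with a one-point register. -/
def Converts {k : ℕ} {d d' : Fin k → ℕ} (ψ : PureState d) (φ : PureState d') : Prop :=
  ∃ Λ : RegOp d Unit → RegOp d' Unit, IsLOCC Λ ∧ Λ (fun _ => ketbra ψ) = fun _ => ketbra φ

/-! ## Direct sums, tensor products and local unitary equivalence -/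

/-- The image of a vector under a product of coordinate embeddings `ℂ^(d j) → ℂ^(d' j)`. -/
noncomputable def embed {k : ℕ} {d d' : Fin k → ℕ} (e : (j : Fin k) → Fin (d j) ↪ Fin (d' j))
    (ψ : PureState d) : PureState d' :=
  Function.extend (fun x j => e j (x j)) ψ 0

/-- `ψ ⊕ φ`. -/
noncomputable def dsum {k : ℕ} {d d' : Fin k → ℕ} (ψ : PureState d) (φ : PureState d') :
    PureState (fun j => d j + d' j) :=
  embed (fun j => Fin.castAddEmb (d' j)) ψ + embed (fun j => Fin.natAddEmb (d j)) φ

/-- `ψ ⊗ φ`. -/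
def tprod {k : ℕ} {d d' : Fin k → ℕ} (ψ : PureState d) (φ : PureState d') :
    PureState (fun j => d j * d' j) := fun x =>
  ψ (fun j => (finProdFinEquiv.symm (x j)).1) * φ (fun j => (finProdFinEquiv.symm (x j)).2)

/-- Local unitary equivalence through partial isometries `U j`. -/
def LUEquiv {k : ℕ} (a b : Σ d : Fin k → ℕ, PureState d) : Prop :=
  ∃ U : (j : Fin k) → Matrix (Fin (b.1 j)) (Fin (a.1 j)) ℂ,
    (∀ j, U j * (U j)ᴴ * U j = U j) ∧
    b.2 = tensorOp U *ᵥ a.2 ∧ a.2 = tensorOp (fun j => (U j)ᴴ) *ᵥ b.2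

/-- The set of local unitary equivalence classes of unnormalised `k`-partite pure states. (Local
unitary equivalence is an equivalence relation, so that this quotient by the relation it generates
is the set of its classes.) -/
def S (k : ℕ) : Type := Quot (LUEquiv (k := k))

/-- The class of a vector. -/
def S.mk {k : ℕ} {d : Fin k → ℕ} (ψ : PureState d) : S k := Quot.mk _ ⟨d, ψ⟩

/-- `c |0…0⟩` in `ℂ ⊗ ⋯ ⊗ ℂ`. -/
def scalarState (k : ℕ) (c : ℂ) : PureState (fun _ : Fin k => 1) := fun _ => c

section Lemmas

variable {k : ℕ} {d d' d₁ d₂ d₃ : Fin k → ℕ}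

theorem tuple_injective (e : (j : Fin k) → Fin (d j) ↪ Fin (d' j)) :
    Function.Injective (fun (x : Idx d) j => e j (x j)) := by
  intro x y h
  funext j
  exact (e j).injective (congrFun h j)

theorem embed_apply (e : (j : Fin k) → Fin (d j) ↪ Fin (d' j)) (ψ : PureState d) (x : Idx d) :
    embed e ψ (fun j => e j (x j)) = ψ x :=
  (tuple_injective e).extend_apply ψ 0 x

theorem embed_apply_of_not (e : (j : Fin k) → Fin (d j) ↪ Fin (d' j)) (ψ : PureState d)
    (y : Idx d') (h : ¬ ∃ x : Idx d, (fun j => e j (x j)) = y) : embed e ψ y = 0 := by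
  simp [embed, Function.extend_apply' _ _ _ h]

theorem embed_unique (e : (j : Fin k) → Fin (d j) ↪ Fin (d' j)) (ψ : PureState d)
    (φ : PureState d') (h1 : ∀ x, φ (fun j => e j (x j)) = ψ x)
    (h2 : ∀ y, (¬ ∃ x : Idx d, (fun j => e j (x j)) = y) → φ y = 0) : embed e ψ = φ := by
  funext y
  by_cases h : ∃ x : Idx d, (fun j => e j (x j)) = y
  · obtain ⟨x, rfl⟩ := h
    rw [embed_apply, h1]
  · rw [embed_apply_of_not e ψ y h, h2 y h]

theorem embed_zero (e : (j : Fin k) → Fin (d j) ↪ Fin (d' j)) :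
    embed e (0 : PureState d) = 0 :=
  embed_unique _ _ _ (fun _ => rfl) (fun _ _ => rfl)

theorem embed_add (e : (j : Fin k) → Fin (d j) ↪ Fin (d' j)) (ψ φ : PureState d) :
    embed e (ψ + φ) = embed e ψ + embed e φ := by
  apply embed_unique
  · intro x
    simp [embed_apply]
  · intro y h
    simp [embed_apply_of_not _ _ _ h]

theorem embed_embed (e : (j : Fin k) → Fin (d₁ j) ↪ Fin (d₂ j))
    (e' : (j : Fin k) → Fin (d₂ j) ↪ Fin (d₃ j)) (ψ : PureState d₁) :
    embed e' (embed e ψ) = embed (fun j => (e j).trans (e' j)) ψ := by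
  symm
  apply embed_unique
  · intro x
    exact (embed_apply e' (embed e ψ) (fun j => e j (x j))).trans (embed_apply e ψ x)
  · intro y h
    by_cases h' : ∃ x : Idx d₂, (fun j => e' j (x j)) = y
    · obtain ⟨x, rfl⟩ := h'
      rw [embed_apply]
      apply embed_apply_of_not
      rintro ⟨z, rfl⟩
      exact h ⟨z, rfl⟩
    · exact embed_apply_of_not _ _ _ h'

theorem tensorOp_embed (e : (j : Fin k) → Fin (d j) ↪ Fin (d₁ j))
    (e' : (j : Fin k) → Fin (d' j) ↪ Fin (d₂ j))
    (U : (j : Fin k) → Matrix (Fin (d' j)) (Fin (d j)) ℂ)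
    (M : (j : Fin k) → Matrix (Fin (d₂ j)) (Fin (d₁ j)) ℂ)
    (h1 : ∀ j a b, M j (e' j a) (e j b) = U j a b)
    (h2 : ∀ j y b, (¬ ∃ a, e' j a = y) → M j y (e j b) = 0) (ψ : PureState d) :
    tensorOp M *ᵥ embed e ψ = embed e' (tensorOp U *ᵥ ψ) := by
  have key : ∀ y, (tensorOp M *ᵥ embed e ψ) y = ∑ b : Idx d, (∏ j, M j (y j) (e j (b j))) * ψ b := by
    intro y
    simp only [Matrix.mulVec, dotProduct, tensorOp, Matrix.of_apply]
    symm
    rw [← Finset.sum_subset (Finset.subset_univ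
      (Finset.univ.map ⟨fun (x : Idx d) j => e j (x j), tuple_injective e⟩)) ?_]
    · rw [Finset.sum_map]
      apply Finset.sum_congr rfl
      intro x _
      simp only [Function.Embedding.coeFn_mk]
      rw [embed_apply]
    · intro x _ hx
      rw [embed_apply_of_not, mul_zero]
      rintro ⟨z, rfl⟩
      exact hx (by simp)
  symm
  apply embed_unique
  · intro x
    rw [key]
    simp [h1, Matrix.mulVec, dotProduct, tensorOp]
  · intro y h
    rw [key]
    apply Finset.sum_eq_zero
    intro b _
    have : ∃ j, ¬ ∃ a, e' j a = y j := by
      by_contra hc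
      push Not at hc
      choose x hx using hc
      exact h ⟨x, funext hx⟩
    obtain ⟨j, hj⟩ := this
    rw [Finset.prod_eq_zero (Finset.mem_univ j) (h2 j _ _ hj), zero_mul]

theorem tensorOp_one : tensorOp (fun j => (1 : Matrix (Fin (d j)) (Fin (d j)) ℂ)) = 1 := by
  ext y x
  simp only [tensorOp, Matrix.of_apply, Matrix.one_apply]
  by_cases h : y = x
  · subst h
    simp
  · rw [if_neg h]
    obtain ⟨j, hj⟩ := Function.ne_iff.mp h
    exact Finset.prod_eq_zero (Finset.mem_univ j) (if_neg hj)

/-- The matrix of a coordinate embedding. -/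
def embMat {m n : ℕ} (e : Fin m ↪ Fin n) : Matrix (Fin n) (Fin m) ℂ :=
  Matrix.of fun y x => if y = e x then 1 else 0

theorem embMat_conjTranspose_mul {m n : ℕ} (e : Fin m ↪ Fin n) :
    (embMat e)ᴴ * embMat e = 1 := by
  ext a b
  simp [embMat, Matrix.mul_apply, Matrix.one_apply, apply_ite, eq_comm]

theorem embed_refl (ψ : PureState d) :
    embed (fun j => Function.Embedding.refl (Fin (d j))) ψ = ψ :=
  embed_unique _ _ _ (fun _ => rfl) (fun y h => (h ⟨y, rfl⟩).elim)

theorem sound_embed (e : (j : Fin k) → Fin (d j) ↪ Fin (d' j)) (ψ : PureState d) :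
    S.mk ψ = S.mk (embed e ψ) := by
  apply Quot.sound
  refine ⟨fun j => embMat (e j), ?_, ?_, ?_⟩
  · intro j
    rw [Matrix.mul_assoc, embMat_conjTranspose_mul, Matrix.mul_one]
  · have := tensorOp_embed (fun j => Function.Embedding.refl (Fin (d j))) e
      (fun j => 1) (fun j => embMat (e j))
      (by intro j a b; simp [embMat, Matrix.one_apply])
      (by
        intro j y b h
        simp only [embMat, Matrix.of_apply]
        exact if_neg fun h' => h ⟨b, h'.symm⟩) ψ
    rw [tensorOp_one, Matrix.one_mulVec, embed_refl] at this
    exact this.symm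
  · have := tensorOp_embed e (fun j => Function.Embedding.refl (Fin (d j)))
      (fun j => 1) (fun j => (embMat (e j))ᴴ)
      (by
        intro j a b
        simp [embMat, Matrix.one_apply, apply_ite, eq_comm])
      (by intro j y b h; exact (h ⟨y, rfl⟩).elim) ψ
    rw [tensorOp_one, Matrix.one_mulVec, embed_refl] at this
    exact this.symm

theorem mk_zero : S.mk (0 : PureState d) = S.mk (0 : PureState d') := by
  apply Quot.sound
  refine ⟨fun j => 0, ?_, ?_, ?_⟩
  · intro j
    simp
  · simp
  · simp

/-- Block diagonal matrices. -/
def blockMat {m n m' n' : ℕ} (A : Matrix (Fin m) (Fin n) ℂ) (B : Matrix (Fin m') (Fin n') ℂ) :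
    Matrix (Fin (m + m')) (Fin (n + n')) ℂ :=
  (Matrix.fromBlocks A 0 0 B).submatrix finSumFinEquiv.symm finSumFinEquiv.symm

theorem blockMat_mul {m n l m' n' l' : ℕ} (A : Matrix (Fin m) (Fin n) ℂ)
    (B : Matrix (Fin m') (Fin n') ℂ) (C : Matrix (Fin n) (Fin l) ℂ)
    (D : Matrix (Fin n') (Fin l') ℂ) :
    blockMat A B * blockMat C D = blockMat (A * C) (B * D) := by
  rw [blockMat, blockMat, Matrix.submatrix_mul_equiv, Matrix.fromBlocks_multiply]
  simp [blockMat]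

theorem blockMat_conjTranspose {m n m' n' : ℕ} (A : Matrix (Fin m) (Fin n) ℂ)
    (B : Matrix (Fin m') (Fin n') ℂ) : (blockMat A B)ᴴ = blockMat Aᴴ Bᴴ := by
  simp [blockMat, Matrix.fromBlocks_conjTranspose]

theorem tensorOp_dsum {d'' d''' : Fin k → ℕ}
    (U : (j : Fin k) → Matrix (Fin (d' j)) (Fin (d j)) ℂ)
    (V : (j : Fin k) → Matrix (Fin (d''' j)) (Fin (d'' j)) ℂ) (ψ : PureState d)
    (φ : PureState d'') :
    tensorOp (fun j => blockMat (U j) (V j)) *ᵥ dsum ψ φ =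
      dsum (tensorOp U *ᵥ ψ) (tensorOp V *ᵥ φ) := by
  rw [dsum, dsum, Matrix.mulVec_add]
  congr 1
  · apply tensorOp_embed
    · intro j a b
      simp [blockMat]
    · intro j y b h
      induction y using Fin.addCases with
      | left a => exact (h ⟨a, rfl⟩).elim
      | right a => simp [blockMat]
  · apply tensorOp_embed
    · intro j a b
      simp [blockMat]
    · intro j y b h
      induction y using Fin.addCases with
      | left a => simp [blockMat]
      | right a => exact (h ⟨a, rfl⟩).elim

/-- Kronecker products. -/
def kronMat {m n m' n' : ℕ} (A : Matrix (Fin m) (Fin n) ℂ) (B : Matrix (Fin m') (Fin n') ℂ) :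
    Matrix (Fin (m * m')) (Fin (n * n')) ℂ :=
  (Matrix.kronecker A B).submatrix finProdFinEquiv.symm finProdFinEquiv.symm

theorem kronMat_mul {m n l m' n' l' : ℕ} (A : Matrix (Fin m) (Fin n) ℂ)
    (B : Matrix (Fin m') (Fin n') ℂ) (C : Matrix (Fin n) (Fin l) ℂ)
    (D : Matrix (Fin n') (Fin l') ℂ) :
    kronMat A B * kronMat C D = kronMat (A * C) (B * D) := by
  rw [kronMat, kronMat, Matrix.submatrix_mul_equiv]
  simp only [Matrix.kronecker, ← Matrix.mul_kronecker_mul]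
  rfl

theorem kronMat_conjTranspose {m n m' n' : ℕ} (A : Matrix (Fin m) (Fin n) ℂ)
    (B : Matrix (Fin m') (Fin n') ℂ) : (kronMat A B)ᴴ = kronMat Aᴴ Bᴴ := by
  rw [kronMat, Matrix.conjTranspose_submatrix]
  simp only [Matrix.kronecker, Matrix.conjTranspose_kronecker]
  rfl

/-- Product basis labels of a tensor product are pairs of product basis labels. -/
def idxProd (d d' : Fin k → ℕ) : Idx d × Idx d' ≃ Idx (fun j => d j * d' j) where
  toFun p j := finProdFinEquiv (p.1 j, p.2 j)
  invFun x := (fun j => (finProdFinEquiv.symm (x j)).1, fun j => (finProdFinEquiv.symm (x j)).2)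
  left_inv p := by simp
  right_inv x := by
    funext j
    exact finProdFinEquiv.apply_symm_apply (x j)

theorem tprod_idxProd (ψ : PureState d) (φ : PureState d') (x : Idx d) (y : Idx d') :
    tprod ψ φ (idxProd d d' (x, y)) = ψ x * φ y := by
  simp [tprod, idxProd]

theorem tensorOp_tprod {d'' d''' : Fin k → ℕ}
    (U : (j : Fin k) → Matrix (Fin (d' j)) (Fin (d j)) ℂ)
    (V : (j : Fin k) → Matrix (Fin (d''' j)) (Fin (d'' j)) ℂ) (ψ : PureState d)
    (φ : PureState d'') :
    tensorOp (fun j => kronMat (U j) (V j)) *ᵥ tprod ψ φ =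
      tprod (tensorOp U *ᵥ ψ) (tensorOp V *ᵥ φ) := by
  funext z
  obtain ⟨⟨y, y'⟩, rfl⟩ := (idxProd d' d''').surjective z
  rw [tprod_idxProd]
  simp only [Matrix.mulVec, dotProduct]
  rw [← (idxProd d d'').sum_comp, Finset.sum_mul_sum, Fintype.sum_prod_type]
  apply Finset.sum_congr rfl
  intro x _
  apply Finset.sum_congr rfl
  intro x' _
  rw [tprod_idxProd]
  have : tensorOp (fun j => kronMat (U j) (V j)) (idxProd d' d''' (y, y')) (idxProd d d'' (x, x')) =
      tensorOp U y x * tensorOp V y' x' := by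
    simp [tensorOp, kronMat, idxProd, Finset.prod_mul_distrib, -finProdFinEquiv_symm_apply]
  rw [this]
  ring

theorem dsum_rel {a b : Σ d : Fin k → ℕ, PureState d} {a' b' : Σ d : Fin k → ℕ, PureState d}
    (h : LUEquiv a b) (h' : LUEquiv a' b') :
    LUEquiv ⟨_, dsum a.2 a'.2⟩ ⟨_, dsum b.2 b'.2⟩ := by
  obtain ⟨U, hU, h1, h2⟩ := h
  obtain ⟨V, hV, h1', h2'⟩ := h'
  refine ⟨fun j => blockMat (U j) (V j), ?_, ?_, ?_⟩
  · intro j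
    rw [blockMat_conjTranspose, blockMat_mul, blockMat_mul, hU, hV]
  · simp only [tensorOp_dsum, ← h1, ← h1']
  · simp only [blockMat_conjTranspose]
    rw [tensorOp_dsum, ← h2, ← h2']

theorem tprod_rel {a b : Σ d : Fin k → ℕ, PureState d} {a' b' : Σ d : Fin k → ℕ, PureState d}
    (h : LUEquiv a b) (h' : LUEquiv a' b') :
    LUEquiv ⟨_, tprod a.2 a'.2⟩ ⟨_, tprod b.2 b'.2⟩ := by
  obtain ⟨U, hU, h1, h2⟩ := h
  obtain ⟨V, hV, h1', h2'⟩ := h'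
  refine ⟨fun j => kronMat (U j) (V j), ?_, ?_, ?_⟩
  · intro j
    rw [kronMat_conjTranspose, kronMat_mul, kronMat_mul, hU, hV]
  · simp only [tensorOp_tprod, ← h1, ← h1']
  · simp only [kronMat_conjTranspose]
    rw [tensorOp_tprod, ← h2, ← h2']

theorem LUEquiv.refl (a : Σ d : Fin k → ℕ, PureState d) : LUEquiv a a := by
  refine ⟨fun j => 1, ?_, ?_, ?_⟩
  · intro j
    simp
  · rw [tensorOp_one, Matrix.one_mulVec]
  · simp only [Matrix.conjTranspose_one]
    rw [tensorOp_one, Matrix.one_mulVec]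

/-- A bijective relabelling does not change the class. -/
theorem sound_equiv (e : (j : Fin k) → Fin (d j) ≃ Fin (d' j)) (ψ : PureState d)
    (φ : PureState d') (h : ∀ x, φ (fun j => e j (x j)) = ψ x) : S.mk ψ = S.mk φ := by
  rw [sound_embed (fun j => (e j).toEmbedding) ψ]
  congr 1
  apply embed_unique
  · exact h
  · intro y hy
    exact (hy ⟨fun j => (e j).symm (y j), by simp⟩).elim

theorem embed_tprod (e : (j : Fin k) → Fin (d j) ↪ Fin (d' j)) (ψ : PureState d)
    (φ : PureState d₁) :
    tprod (embed e ψ) φ = embed (fun j => (finProdFinEquiv.symm.toEmbedding.trans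
      ((e j).prodMap (Function.Embedding.refl _))).trans finProdFinEquiv.toEmbedding)
        (tprod ψ φ) := by
  symm
  apply embed_unique
  · intro x
    have := embed_apply e ψ (fun j => (finProdFinEquiv.symm (x j)).1)
    simp [tprod, this, -finProdFinEquiv_symm_apply]
  · intro y h
    have : ¬ ∃ x : Idx d, (fun j => e j (x j)) = fun j => (finProdFinEquiv.symm (y j)).1 := by
      rintro ⟨x, hx⟩
      apply h
      refine ⟨fun j => finProdFinEquiv (x j, (finProdFinEquiv.symm (y j)).2), ?_⟩
      funext j
      have := congrFun hx j
      simp only [Function.Embedding.trans_apply, Equiv.coe_toEmbedding, Equiv.symm_apply_apply,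
        Function.Embedding.coe_prodMap, Prod.map_apply, Function.Embedding.refl_apply, this]
      exact finProdFinEquiv.apply_symm_apply (y j)
    rw [tprod, embed_apply_of_not e ψ _ this, zero_mul]

theorem add_tprod (ψ φ : PureState d) (χ : PureState d') :
    tprod (ψ + φ) χ = tprod ψ χ + tprod φ χ := by
  funext x
  simp [tprod, add_mul]

end Lemmas

/-! ## The semiring of classes -/

noncomputable instance (k : ℕ) : Add (S k) :=
  ⟨Quot.map₂ (fun a b => ⟨_, dsum a.2 b.2⟩)
    (fun a _ _ h => dsum_rel (LUEquiv.refl a) h) (fun _ _ b h => dsum_rel h (LUEquiv.refl b))⟩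

instance (k : ℕ) : Mul (S k) :=
  ⟨Quot.map₂ (fun a b => ⟨_, tprod a.2 b.2⟩)
    (fun a _ _ h => tprod_rel (LUEquiv.refl a) h) (fun _ _ b h => tprod_rel h (LUEquiv.refl b))⟩

instance (k : ℕ) : Zero (S k) := ⟨S.mk (scalarState k 0)⟩

instance (k : ℕ) : One (S k) := ⟨S.mk (scalarState k 1)⟩

theorem mk_add_mk {k : ℕ} {d d' : Fin k → ℕ} (ψ : PureState d) (φ : PureState d') :
    S.mk ψ + S.mk φ = S.mk (dsum ψ φ) := rfl

theorem mk_mul_mk {k : ℕ} {d d' : Fin k → ℕ} (ψ : PureState d) (φ : PureState d') :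
    S.mk ψ * S.mk φ = S.mk (tprod ψ φ) := rfl

theorem zero_def {k : ℕ} {d : Fin k → ℕ} : (0 : S k) = S.mk (0 : PureState d) :=
  mk_zero (d := fun _ => 1)

theorem S.ind {k : ℕ} {p : S k → Prop} (h : ∀ (d : Fin k → ℕ) (ψ : PureState d), p (S.mk ψ))
    (a : S k) : p a :=
  Quot.ind (fun a => h a.1 a.2) a

theorem S.add_comm' {k : ℕ} (a b : S k) : a + b = b + a := by
  induction a using S.ind with | h d ψ => ?_
  induction b using S.ind with | h d' φ => ?_
  rw [mk_add_mk, mk_add_mk, sound_embed (fun j => finAddFlip.toEmbedding) (dsum ψ φ)]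
  congr 1
  rw [dsum, dsum, embed_add, embed_embed, embed_embed, add_comm]
  congr 2
  · funext j
    ext x
    simp
  · funext j
    ext x
    simp

theorem S.mul_comm' {k : ℕ} (a b : S k) : a * b = b * a := by
  induction a using S.ind with | h d ψ => ?_
  induction b using S.ind with | h d' φ => ?_
  rw [mk_mul_mk, mk_mul_mk]
  apply sound_equiv (fun j => (finProdFinEquiv.symm.trans (Equiv.prodComm _ _)).trans
    finProdFinEquiv)
  intro x
  simp only [tprod, Equiv.trans_apply, Equiv.symm_apply_apply, Equiv.prodComm_apply, Prod.fst_swap,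
    Prod.snd_swap]
  ring

theorem S.add_assoc' {k : ℕ} (a b c : S k) : a + b + c = a + (b + c) := by
  induction a using S.ind with | h d ψ => ?_
  induction b using S.ind with | h d' φ => ?_
  induction c using S.ind with | h d'' χ => ?_
  simp only [mk_add_mk]
  rw [sound_embed (fun j => (finCongr (Nat.add_assoc _ _ _)).toEmbedding) (dsum (dsum ψ φ) χ)]
  congr 1
  simp only [dsum, embed_add, embed_embed]
  rw [add_assoc]
  congr 2
  congr 1
  funext j
  ext x
  simp [Nat.add_assoc]

theorem S.mul_assoc' {k : ℕ} (a b c : S k) : a * b * c = a * (b * c) := by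
  induction a using S.ind with | h d ψ => ?_
  induction b using S.ind with | h d' φ => ?_
  induction c using S.ind with | h d'' χ => ?_
  simp only [mk_mul_mk]
  apply sound_equiv (fun j => (((finProdFinEquiv.symm.trans
    (finProdFinEquiv.symm.prodCongr (Equiv.refl _))).trans (Equiv.prodAssoc _ _ _)).trans
      ((Equiv.refl _).prodCongr finProdFinEquiv)).trans finProdFinEquiv)
  intro x
  simp only [tprod, Equiv.trans_apply, Equiv.symm_apply_apply, Equiv.prodCongr_apply, Prod.map,
    Equiv.prodAssoc_apply, Equiv.refl_apply]
  ring

theorem S.zero_add' {k : ℕ} (a : S k) : 0 + a = a := by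
  induction a using S.ind with | h d ψ => ?_
  rw [zero_def (d := d), mk_add_mk, dsum, embed_zero, zero_add, ← sound_embed]

theorem S.zero_mul' {k : ℕ} (a : S k) : 0 * a = 0 := by
  induction a using S.ind with | h d ψ => ?_
  rw [zero_def (d := d), mk_mul_mk]
  rw [show tprod (0 : PureState d) ψ = 0 by funext x; simp [tprod]]
  exact mk_zero

theorem S.one_mul' {k : ℕ} (a : S k) : 1 * a = a := by
  induction a using S.ind with | h d ψ => ?_
  refine (mk_mul_mk (scalarState k 1) ψ).trans ?_
  symm
  apply sound_equiv (fun j => (Equiv.uniqueProd (Fin (d j)) (Fin 1)).symm.trans finProdFinEquiv)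
  intro x
  simp only [tprod, scalarState, one_mul, Equiv.trans_apply, Equiv.symm_apply_apply,
    Equiv.uniqueProd_symm_apply]

theorem S.add_mul' {k : ℕ} (a b c : S k) : (a + b) * c = a * c + b * c := by
  induction a using S.ind with | h d ψ => ?_
  induction b using S.ind with | h d' φ => ?_
  induction c using S.ind with | h d'' χ => ?_
  simp only [mk_mul_mk, mk_add_mk]
  rw [sound_embed (fun j => ((((finProdFinEquiv.symm.trans
    (finSumFinEquiv.symm.prodCongr (Equiv.refl _))).trans (Equiv.sumProdDistrib _ _ _)).trans
      (finProdFinEquiv.sumCongr finProdFinEquiv)).trans finSumFinEquiv).toEmbedding)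
      (tprod (dsum ψ φ) χ)]
  congr 1
  rw [dsum, add_tprod, embed_tprod, embed_tprod, embed_add, embed_embed, embed_embed, dsum]
  congr 2
  · funext j
    ext x
    obtain ⟨⟨p, q⟩, rfl⟩ := finProdFinEquiv.surjective x
    simp [-finProdFinEquiv_symm_apply]
  · funext j
    ext x
    obtain ⟨⟨p, q⟩, rfl⟩ := finProdFinEquiv.surjective x
    simp [-finProdFinEquiv_symm_apply]

/-- The commutative semiring `(S k, ⊕, ⊗)`. -/
noncomputable instance (k : ℕ) : CommSemiring (S k) where
  add_assoc := S.add_assoc'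
  zero_add := S.zero_add'
  add_zero a := by rw [S.add_comm', S.zero_add']
  add_comm := S.add_comm'
  mul_assoc := S.mul_assoc'
  mul_comm := S.mul_comm'
  one_mul := S.one_mul'
  mul_one a := by rw [S.mul_comm', S.one_mul']
  left_distrib a b c := by rw [S.mul_comm', S.add_mul', S.mul_comm' b, S.mul_comm' c]
  right_distrib := S.add_mul'
  zero_mul := S.zero_mul'
  mul_zero a := by rw [S.mul_comm', S.zero_mul']
  nsmul := nsmulRec

/-! ## Monotone homomorphisms -/

/-- The LOCC order on classes: `a ≤ b` if a representative of `b` converts to one of `a`. Locally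
unitarily equivalent vectors convert to each other, so the choice of representatives is
immaterial. -/
def S.LOCCLE {k : ℕ} (a b : S k) : Prop :=
  ∃ (d d' : Fin k → ℕ) (φ : PureState d) (ψ : PureState d'),
    S.mk φ = a ∧ S.mk ψ = b ∧ Converts ψ φ

/-- Order preserving homomorphisms. -/
def IsMonotone {k : ℕ} (f : S k →+* ℝ≥0) : Prop :=
  ∀ a b : S k, S.LOCCLE a b → f a ≤ f b

/-- `(a^(1/α) + b^(1/α))^α`, which at `α = 0` means its limit `max a b`. -/
noncomputable def powerMean (α : ℝ) (a b : ℝ≥0) : ℝ≥0 :=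
  if α = 0 then max a b else (a ^ (1 / α) + b ^ (1 / α)) ^ α

end LOCC

/-! For a monotone `f`, the map `p ↦ f(√p |0…0⟩)` is multiplicative and monotone, hence a power `p ^
α`. Measure a projection `P` on each of `n` copies of `φ`, and keep the outcomes in which `P` occurs
exactly `m` times. All `n.choose m` of them are locally unitarily equivalent, so local corrections
and forgetting the outcome yield one pure state with weight `n.choose m`
(`IsMonotone.choose_mul_le`). Raised to the power `1/α` and summed over `m`, these bounds form a
binomial expansion with polynomial loss, which disappears as `n → ∞`. For `α = 0` only the
contractions `P` and `1 - P` are needed. Testing the inequality on `1 ⊕ 1` gives `α ≤ 1`.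

Conversely, the inequality says that `g = f ^ (1/α)` does not increase in total under projective
measurements. Dilation of Kraus operators to an isometry extends this to all local measurements, and
thus to ensembles produced by an LOCC channel (`HasEnsemble.of_isLOCC`). If the output is `|φ⟩⟨φ|`,
every ensemble member is `c l • φ` with `∑ ‖c l‖² = 1`; since `g` scales by `‖c l‖²`, the total is
`g φ`. The argument runs in an ordered additive monoid, so that `α = 0` is the same proof with `max`
as addition. -/

namespace LOCC

open scoped ComplexOrder

/-! ### Local operators, isometries and equivalence classes -/

section Basics

variable {k : ℕ} {d d' d'' : Fin k → ℕ}

theorem tensorOp_mul (U : (j : Fin k) → Matrix (Fin (d'' j)) (Fin (d' j)) ℂ)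
    (V : (j : Fin k) → Matrix (Fin (d' j)) (Fin (d j)) ℂ) :
    tensorOp U * tensorOp V = tensorOp (fun j => U j * V j) := by
  ext y x
  simp only [tensorOp, Matrix.mul_apply, Matrix.of_apply]
  rw [Finset.prod_univ_sum, Fintype.piFinset_univ]
  simp only [Finset.prod_mul_distrib]

theorem tensorOp_conjTranspose (U : (j : Fin k) → Matrix (Fin (d' j)) (Fin (d j)) ℂ) :
    (tensorOp U)ᴴ = tensorOp (fun j => (U j)ᴴ) := by
  ext y x
  simp [tensorOp, Matrix.conjTranspose_apply]

/-- `localOp i K` is the tensor product of `K` with identifications of the other factors. -/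
theorem localOp_eq_tensorOp (i : Fin k) (K : Matrix (Fin (d' i)) (Fin (d i)) ℂ)
    (U : (j : Fin k) → Matrix (Fin (d' j)) (Fin (d j)) ℂ) (hi : U i = K)
    (hU : ∀ j, j ≠ i → ∀ y x, U j y x = if (y : ℕ) = (x : ℕ) then 1 else 0) :
    (localOp i K : Matrix (Idx d') (Idx d) ℂ) = tensorOp U := by
  ext y x
  simp only [localOp, tensorOp, Matrix.of_apply]
  rw [← Finset.mul_prod_erase _ _ (Finset.mem_univ i), hi]
  split_ifs with h
  · rw [Finset.prod_eq_one, mul_one]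
    intro j hj
    have hj' := (Finset.mem_erase.mp hj).1
    rw [hU j hj', if_pos (h j hj')]
  · push Not at h
    obtain ⟨j, hj, hne⟩ := h
    rw [Finset.prod_eq_zero (Finset.mem_erase.mpr ⟨hj, Finset.mem_univ j⟩), mul_zero]
    rw [hU j hj, if_neg hne]

theorem localOp_eq_tensorOp_update (i : Fin k) (K : Matrix (Fin (d i)) (Fin (d i)) ℂ) :
    (localOp i K : Matrix (Idx d) (Idx d) ℂ) =
      tensorOp (Function.update (fun _ => 1) i K) := by
  apply localOp_eq_tensorOp
  · simp
  · intro j hj y x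
    rw [Function.update_of_ne hj, Matrix.one_apply]
    simp [Fin.ext_iff]

theorem localOp_one (i : Fin k) :
    (localOp i (1 : Matrix (Fin (d i)) (Fin (d i)) ℂ) : Matrix (Idx d) (Idx d) ℂ) = 1 := by
  rw [localOp_eq_tensorOp_update, ← tensorOp_one]
  congr 1
  exact Function.update_eq_self i (fun j => (1 : Matrix (Fin (d j)) (Fin (d j)) ℂ))

theorem conj_ketbra (M : Matrix (Idx d') (Idx d) ℂ) (ψ : PureState d) :
    M * ketbra ψ * Mᴴ = ketbra (M *ᵥ ψ) := by
  rw [ketbra, ketbra, Matrix.mul_vecMulVec, Matrix.vecMulVec_mul, Matrix.star_mulVec]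

theorem ketbra_smul (c : ℂ) (ψ : PureState d) :
    ketbra (c • ψ) = ((‖c‖ ^ 2 : ℝ) : ℂ) • ketbra ψ := by
  ext x y
  simp only [ketbra, Matrix.vecMulVec_apply, Pi.smul_apply, Pi.star_apply, smul_eq_mul, star_mul',
    Matrix.smul_apply]
  have : ((‖c‖ ^ 2 : ℝ) : ℂ) = c * star c := by
    rw [Complex.ofReal_pow]
    exact (Complex.mul_conj' c).symm
  rw [this]
  ring

theorem mk_tensorOp_of_isometry (U : (j : Fin k) → Matrix (Fin (d' j)) (Fin (d j)) ℂ)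
    (hU : ∀ j, (U j)ᴴ * U j = 1) (ψ : PureState d) : S.mk (tensorOp U *ᵥ ψ) = S.mk ψ := by
  symm
  apply Quot.sound
  refine ⟨U, fun j => ?_, rfl, ?_⟩
  · rw [Matrix.mul_assoc, hU, Matrix.mul_one]
  · simp only
    rw [Matrix.mulVec_mulVec, tensorOp_mul]
    simp only [hU]
    rw [tensorOp_one, Matrix.one_mulVec]

/-- Two families of dimensions are allowed because dilations enlarge the space of party `i`. -/
theorem mk_localOp_of_isometry (hd : ∀ j, j ≠ i → d' j = d j)
    (V : Matrix (Fin (d' i)) (Fin (d i)) ℂ) (hV : Vᴴ * V = 1) (ψ : PureState d) :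
    S.mk ((localOp i V : Matrix (Idx d') (Idx d) ℂ) *ᵥ ψ) = S.mk ψ := by
  -- The factor is `V` at party `i`, transported along `j = i`, and the relabelling along `d' j = d
  -- j` elsewhere.
  have : ∀ j, ∃ W : Matrix (Fin (d' j)) (Fin (d j)) ℂ, Wᴴ * W = 1 ∧
      (∀ h : j = i, W = h ▸ V) ∧
      (j ≠ i → ∀ y x, W y x = if (y : ℕ) = (x : ℕ) then 1 else 0) := by
    intro j
    by_cases h : j = i
    · subst h
      exact ⟨V, hV, fun _ => rfl, fun h => (h rfl).elim⟩
    · refine ⟨embMat (finCongr (hd j h).symm).toEmbedding, embMat_conjTranspose_mul _,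
        fun h' => (h h').elim, fun _ y x => ?_⟩
      simp [embMat, Fin.ext_iff]
  choose U h1 h2 h3 using this
  rw [localOp_eq_tensorOp i V U (h2 i rfl) h3]
  exact mk_tensorOp_of_isometry U h1 ψ

/-- `Uᴴ * U` is a projection, so `1 - Uᴴ * U` equals its own square. -/
theorem contraction_of_partial_isometry {m n : ℕ} (U : Matrix (Fin m) (Fin n) ℂ)
    (hU : U * Uᴴ * U = U) : (1 - Uᴴ * U).PosSemidef := by
  have : 1 - Uᴴ * U = (1 - Uᴴ * U)ᴴ * (1 - Uᴴ * U) := by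
    rw [Matrix.conjTranspose_sub, Matrix.conjTranspose_one, Matrix.conjTranspose_mul,
      Matrix.conjTranspose_conjTranspose, Matrix.sub_mul, Matrix.one_mul, Matrix.mul_sub,
      Matrix.mul_one, Matrix.mul_assoc Uᴴ U, ← Matrix.mul_assoc U, hU, sub_self, sub_zero]
  rw [this]
  exact Matrix.posSemidef_conjTranspose_mul_self _

theorem contraction_mul {l m n : ℕ} (V : Matrix (Fin l) (Fin m) ℂ) (U : Matrix (Fin m) (Fin n) ℂ)
    (hV : (1 - Vᴴ * V).PosSemidef) (hU : (1 - Uᴴ * U).PosSemidef) :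
    (1 - (V * U)ᴴ * (V * U)).PosSemidef := by
  have : 1 - (V * U)ᴴ * (V * U) = (1 - Uᴴ * U) + Uᴴ * (1 - Vᴴ * V) * U := by
    rw [Matrix.conjTranspose_mul, Matrix.mul_sub, Matrix.sub_mul, Matrix.mul_one]
    simp only [Matrix.mul_assoc]
    abel
  rw [this]
  exact hU.add (hV.conjTranspose_mul_mul_same U)

/-- Vectors of the same class are related by local contractions. -/
theorem exists_contractions (a b : Σ d : Fin k → ℕ, PureState d)
    (h : Relation.EqvGen LUEquiv a b) :
    ∃ U : (j : Fin k) → Matrix (Fin (b.1 j)) (Fin (a.1 j)) ℂ,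
      (∀ j, (1 - (U j)ᴴ * U j).PosSemidef) ∧ b.2 = tensorOp U *ᵥ a.2 := by
  -- Induction on the generated equivalence needs both directions because of symmetry. Contractions,
  -- unlike partial isometries, are closed under composition.
  suffices (∃ U : (j : Fin k) → Matrix (Fin (b.1 j)) (Fin (a.1 j)) ℂ,
      (∀ j, (1 - (U j)ᴴ * U j).PosSemidef) ∧ b.2 = tensorOp U *ᵥ a.2) ∧
      ∃ U : (j : Fin k) → Matrix (Fin (a.1 j)) (Fin (b.1 j)) ℂ,
      (∀ j, (1 - (U j)ᴴ * U j).PosSemidef) ∧ a.2 = tensorOp U *ᵥ b.2 from this.1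
  induction h with
  | rel a b h =>
    obtain ⟨U, hU, h1, h2⟩ := h
    refine ⟨⟨U, fun j => contraction_of_partial_isometry _ (hU j), h1⟩,
      ⟨_, fun j => contraction_of_partial_isometry _ ?_, h2⟩⟩
    have := congrArg Matrix.conjTranspose (hU j)
    simpa [Matrix.conjTranspose_mul, Matrix.mul_assoc] using this
  | refl a =>
    have : ∃ U : (j : Fin k) → Matrix (Fin (a.1 j)) (Fin (a.1 j)) ℂ,
        (∀ j, (1 - (U j)ᴴ * U j).PosSemidef) ∧ a.2 = tensorOp U *ᵥ a.2 := by
      refine ⟨fun _ => 1, fun j => ?_, ?_⟩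
      · simpa using Matrix.PosSemidef.zero
      · rw [tensorOp_one, Matrix.one_mulVec]
    exact ⟨this, this⟩
  | symm a b _ ih => exact ⟨ih.2, ih.1⟩
  | trans a b c _ _ ih1 ih2 =>
    obtain ⟨⟨U, hU, hU'⟩, V, hV, hV'⟩ := ih1
    obtain ⟨⟨W, hW, hW'⟩, Z, hZ, hZ'⟩ := ih2
    refine ⟨⟨fun j => W j * U j, fun j => contraction_mul _ _ (hW j) (hU j), ?_⟩,
      ⟨fun j => V j * Z j, fun j => contraction_mul _ _ (hV j) (hZ j), ?_⟩⟩
    · rw [← tensorOp_mul, ← Matrix.mulVec_mulVec, ← hU', ← hW']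
    · rw [← tensorOp_mul, ← Matrix.mulVec_mulVec, ← hZ', ← hV']

theorem exists_contractions_of_mk_eq {ψ : PureState d} {φ : PureState d'}
    (h : S.mk ψ = S.mk φ) :
    ∃ U : (j : Fin k) → Matrix (Fin (d' j)) (Fin (d j)) ℂ,
      (∀ j, (1 - (U j)ᴴ * U j).PosSemidef) ∧ φ = tensorOp U *ᵥ ψ :=
  exists_contractions ⟨d, ψ⟩ ⟨d', φ⟩ (Quot.eqvGen_exact h)

/-- Scalar multiples of a state as products with scalar states. -/
theorem mk_smul (c : ℂ) (ψ : PureState d) : S.mk (c • ψ) = S.mk (scalarState k c) * S.mk ψ := by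
  rw [mk_mul_mk]
  apply sound_equiv (fun j => (Equiv.uniqueProd (Fin (d j)) (Fin 1)).symm.trans finProdFinEquiv)
  intro x
  simp only [tprod, scalarState, Equiv.trans_apply, Equiv.symm_apply_apply,
    Equiv.uniqueProd_symm_apply, Pi.smul_apply, smul_eq_mul]

/-- The phase of `c` is a unitary of party `i`, so at least one party is needed. The square root
matches the form in which `f(√p |0…0⟩)` is known. -/
theorem mk_scalarState_norm (i : Fin k) (c : ℂ) :
    S.mk (scalarState k c) = S.mk (scalarState k (Real.sqrt (‖c‖₊ ^ 2 : ℝ≥0) : ℂ)) := by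
  have hn : Real.sqrt ((‖c‖₊ ^ 2 : ℝ≥0) : ℝ) = ‖c‖ := by
    simp
  rw [hn]
  by_cases hc : c = 0
  · simp [hc]
  have hc' : (‖c‖ : ℂ) ≠ 0 := by simpa using hc
  set u : ℂ := c / ‖c‖
  have hu : star u * u = 1 := by
    have : ‖u‖ = 1 := by simp [u, hc]
    have h2 := Complex.conj_mul' u
    rw [this] at h2
    simpa using h2
  have := mk_localOp_of_isometry (d := fun _ => 1) (d' := fun _ => 1) (i := i) (fun _ _ => rfl)
    (u • (1 : Matrix (Fin 1) (Fin 1) ℂ)) (by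
      rw [Matrix.conjTranspose_smul, Matrix.conjTranspose_one, Matrix.smul_mul, Matrix.one_mul,
        smul_smul, hu, one_smul]) (scalarState k (‖c‖ : ℂ))
  rw [← this]
  congr 1
  funext x
  have h1 : (1 : Matrix (Fin 1) (Fin 1) ℂ) (x i) 0 = 1 := by
    rw [Subsingleton.elim (x i) 0, Matrix.one_apply_eq]
  have h2 : c = c / ‖c‖ * ‖c‖ := by
    field_simp
  simpa [Matrix.mulVec, dotProduct, localOp, scalarState, u, h1] using h2

/-- Without parties the direct sum is addition of complex numbers, so `1 + (-1) = 0` rules out a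
homomorphism to `ℝ≥0`. -/
theorem pos_of_hom (f : S k →+* ℝ≥0) : 0 < k := by
  rcases Nat.eq_zero_or_pos k with rfl | h
  · exfalso
    have h : (1 : S 0) + S.mk (scalarState 0 (-1)) = 0 := by
      rw [zero_def (d := fun _ => 1 + 1)]
      refine (mk_add_mk (scalarState 0 1) _).trans ?_
      congr 1
      funext x
      have h1 := embed_apply (d := fun _ : Fin 0 => 1) (d' := fun _ : Fin 0 => 1 + 1)
        (fun j => Fin.castAddEmb 1) (scalarState 0 1) (fun _ => 0)
      have h2 := embed_apply (d := fun _ : Fin 0 => 1) (d' := fun _ : Fin 0 => 1 + 1)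
        (fun j => Fin.natAddEmb 1) (scalarState 0 (-1)) (fun _ => 0)
      rw [Subsingleton.elim (fun j => _) x] at h1 h2
      simp only [dsum, Pi.add_apply, h1, h2]
      simp [scalarState]
    have := congrArg f h
    rw [map_add, map_one, map_zero] at this
    simp at this
  · exact h

end Basics

/-! ### From projective measurements to LOCC channels -/

section Superadditive

variable {k : ℕ} {d d' d'' : Fin k → ℕ}

theorem localOp_diagonal (i : Fin k) (w : Fin (d i) → ℂ) :
    (localOp i (Matrix.diagonal w) : Matrix (Idx d) (Idx d) ℂ) =
      Matrix.diagonal (fun x => w (x i)) := by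
  ext y x
  simp only [localOp, Matrix.of_apply, Matrix.diagonal_apply]
  by_cases h : y = x
  · subst h
    simp
  · rw [if_neg h]
    split_ifs with h1 h2
    · refine (h (funext fun j => ?_)).elim
      by_cases hj : j = i
      · subst hj
        exact h2
      · exact Fin.ext (h1 j hj)
    · rfl
    · rfl

open Classical in
/-- The projection of `φ` to the span of the product basis vectors whose `i`-th label is in `A`. -/
noncomputable def mask (i : Fin k) (A : Set (Fin (d i))) (φ : PureState d) : PureState d :=
  fun x => if x i ∈ A then φ x else 0

theorem exists_projection_mask (i : Fin k) (A : Set (Fin (d i))) :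
    ∃ P : Matrix (Fin (d i)) (Fin (d i)) ℂ, IsStarProjection P ∧ ∀ φ : PureState d,
      (localOp i P : Matrix (Idx d) (Idx d) ℂ) *ᵥ φ = mask i A φ ∧
      (localOp i (1 - P) : Matrix (Idx d) (Idx d) ℂ) *ᵥ φ = mask i Aᶜ φ := by
  classical
  refine ⟨Matrix.diagonal (fun y => if y ∈ A then 1 else 0), ⟨?_, ?_⟩, fun φ => ⟨?_, ?_⟩⟩
  · simp [IsIdempotentElem]
  · rw [IsSelfAdjoint, Matrix.star_eq_conjTranspose, Matrix.diagonal_conjTranspose]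
    congr 1
    funext y
    simp [apply_ite]
  · rw [localOp_diagonal]
    funext x
    simp [Matrix.mulVec_diagonal, mask]
  · rw [← Matrix.diagonal_one, Matrix.diagonal_sub, localOp_diagonal]
    funext x
    by_cases h : x i ∈ A <;> simp [Matrix.mulVec_diagonal, mask, h]

variable {M : Type*} [AddCommMonoid M] [PartialOrder M]

/-- `g` does not increase in total under local two-outcome projective measurements. -/
def ProjSuperadditive (g : S k → M) : Prop :=
  ∀ (d : Fin k → ℕ) (φ : PureState d) (i : Fin k) (P : Matrix (Fin (d i)) (Fin (d i)) ℂ),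
    IsStarProjection P →
      g (S.mk ((localOp i P : Matrix (Idx d) (Idx d) ℂ) *ᵥ φ)) +
        g (S.mk ((localOp i (1 - P) : Matrix (Idx d) (Idx d) ℂ) *ᵥ φ)) ≤ g (S.mk φ)

variable {g : S k → M}

theorem ProjSuperadditive.mask_add_le (hg : ProjSuperadditive g) (φ : PureState d) (i : Fin k)
    (A : Set (Fin (d i))) : g (S.mk (mask i A φ)) + g (S.mk (mask i Aᶜ φ)) ≤ g (S.mk φ) := by
  obtain ⟨P, hP, h⟩ := exists_projection_mask i A
  have := hg d φ i P hP
  rwa [(h φ).1, (h φ).2] at this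

variable [IsOrderedAddMonoid M]

/-- A measurement with many outcomes is a sequence of two-outcome ones, splitting off one value of
`c` at a time. -/
theorem ProjSuperadditive.sum_mask_le (hg : ProjSuperadditive g) (hg0 : ∀ a, 0 ≤ g a)
    (φ : PureState d) (i : Fin k) {J : Type*} (c : Fin (d i) → J) (s : Finset J) :
    ∑ b ∈ s, g (S.mk (mask i {y | c y = b} φ)) ≤ g (S.mk φ) := by
  classical
  suffices ∑ b ∈ s, g (S.mk (mask i {y | c y = b} φ)) ≤ g (S.mk (mask i {y | c y ∈ s} φ)) by
    refine this.trans (le_trans ?_ (hg.mask_add_le φ i {y | c y ∈ s}))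
    exact le_add_of_nonneg_right (hg0 _)
  induction s using Finset.induction_on with
  | empty => simpa using hg0 _
  | insert b s hb ih =>
    rw [Finset.sum_insert hb]
    refine (add_le_add_right ih _).trans ?_
    have := hg.mask_add_le (mask i {y | c y ∈ insert b s} φ) i {y | c y = b}
    convert this using 4
    · funext x
      by_cases h : c (x i) = b <;> simp [mask, h]
    · funext x
      by_cases h : c (x i) = b <;> simp [mask, h, hb]

open scoped MatrixOrder Matrix.Norms.L2Operator in
theorem exists_eq_conjTranspose_mul_self {n : ℕ} {A : Matrix (Fin n) (Fin n) ℂ}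
    (hA : A.PosSemidef) : ∃ R : Matrix (Fin n) (Fin n) ℂ, A = Rᴴ * R :=
  CStarAlgebra.nonneg_iff_eq_star_mul_self.mp hA.nonneg

theorem exists_block_embedding (i : Fin k) (hd : ∀ j, j ≠ i → d'' j = d' j)
    (e : Fin (d' i) ↪ Fin (d'' i)) :
    ∃ E : (j : Fin k) → Fin (d' j) ↪ Fin (d'' j), E i = e ∧
      ∀ j, j ≠ i → (∀ a, (E j a : ℕ) = a) ∧ Function.Surjective (E j) := by
  have : ∀ j, ∃ E : Fin (d' j) ↪ Fin (d'' j), (∀ h : j = i, E = h ▸ e) ∧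
      (j ≠ i → (∀ a, (E a : ℕ) = a) ∧ Function.Surjective E) := by
    intro j
    by_cases h : j = i
    · subst h
      exact ⟨e, fun _ => rfl, fun h => (h rfl).elim⟩
    · exact ⟨(finCongr (hd j h).symm).toEmbedding, fun h' => (h h').elim,
        fun _ => ⟨fun a => by simp, (finCongr (hd j h).symm).surjective⟩⟩
  choose E h1 h2 using this
  exact ⟨E, h1 i rfl, h2⟩

/-- Stacking the `K j` on a square root `R` of the defect gives an isometry `V`, which preserves the
class. Projecting `V ψ` to block `j` leaves an embedded copy of `K j ψ`. The large space enters
through the equivalence `e`, which avoids casts in its dimension. -/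
theorem ProjSuperadditive.sum_kraus_le_of_dilation (hg : ProjSuperadditive g)
    (hg0 : ∀ a, 0 ≤ g a) {i : Fin k} (hd : ∀ j, j ≠ i → d' j = d j)
    (hd' : ∀ j, j ≠ i → d'' j = d j) {J : Type*} [Fintype J]
    (e : (J × Fin (d' i)) ⊕ Fin (d i) ≃ Fin (d'' i))
    (K : J → Matrix (Fin (d' i)) (Fin (d i)) ℂ) (hK : (1 - ∑ j, (K j)ᴴ * K j).PosSemidef)
    (ψ : PureState d) :
    ∑ j, g (S.mk ((localOp i (K j) : Matrix (Idx d') (Idx d) ℂ) *ᵥ ψ)) ≤ g (S.mk ψ) := by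
  classical
  obtain ⟨R, hR⟩ : ∃ R : Matrix (Fin (d i)) (Fin (d i)) ℂ, 1 - ∑ j, (K j)ᴴ * K j = Rᴴ * R :=
    exists_eq_conjTranspose_mul_self hK
  let V : Matrix (Fin (d'' i)) (Fin (d i)) ℂ :=
    Matrix.of fun y x => Sum.elim (fun p => K p.1 p.2 x) (fun b => R b x) (e.symm y)
  have hV : Vᴴ * V = 1 := by
    have h1 : (1 : Matrix (Fin (d i)) (Fin (d i)) ℂ) = ∑ j, (K j)ᴴ * K j + Rᴴ * R := by
      rw [← hR]
      abel
    rw [h1]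
    ext x x'
    simp only [Matrix.mul_apply, Matrix.add_apply, Matrix.sum_apply]
    rw [← e.sum_comp, Fintype.sum_sum_type, Fintype.sum_prod_type]
    simp [V]
  rw [← mk_localOp_of_isometry hd' V hV ψ]
  -- The block of `R` gets the label `none` and is left out of the sum.
  let c : Fin (d'' i) → Option J := fun y => Sum.elim (fun p => some p.1) (fun _ => none) (e.symm y)
  have key := hg.sum_mask_le hg0 ((localOp i V : Matrix (Idx d'') (Idx d) ℂ) *ᵥ ψ) i c
    (Finset.univ.map Function.Embedding.some)
  rw [Finset.sum_map] at key
  refine le_of_eq_of_le (Finset.sum_congr rfl fun j _ => ?_) key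
  congr 1
  obtain ⟨E, hE, hE'⟩ := exists_block_embedding i (fun l hl => (hd' l hl).trans (hd l hl).symm)
    ((⟨fun a => Sum.inl (j, a), fun a b h => by simpa using h⟩ : Fin (d' i) ↪ _).trans
      e.toEmbedding)
  have hEi : ∀ a, E i a = e (Sum.inl (j, a)) := fun a => by rw [hE]; rfl
  rw [sound_embed E]
  congr 1
  apply embed_unique
  · intro x
    simp only [mask, Set.mem_ofPred_eq, c, hEi, Equiv.symm_apply_apply, Sum.elim_inl,
      Function.Embedding.some_apply, if_true]
    simp only [Matrix.mulVec, dotProduct]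
    refine Finset.sum_congr rfl fun z _ => ?_
    congr 1
    simp only [localOp, Matrix.of_apply]
    have : (∀ l, l ≠ i → ((E l (x l) : ℕ) = z l)) ↔ ∀ l, l ≠ i → ((x l : ℕ) = z l) :=
      forall_congr' fun l => forall_congr' fun hl => by rw [(hE' l hl).1]
    simp only [this, hEi, V, Matrix.of_apply, Equiv.symm_apply_apply, Sum.elim_inl]
  · intro y hy
    simp only [mask, Set.mem_ofPred_eq]
    rw [if_neg]
    intro hc
    apply hy
    have : ∀ l, ∃ a, E l a = y l := by
      intro l
      by_cases hl : l = i
      · subst hl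
        obtain ⟨z, hz⟩ := e.surjective (y l)
        simp only [c, ← hz, Equiv.symm_apply_apply, Function.Embedding.some_apply] at hc
        rcases z with ⟨j', a⟩ | b
        · simp only [Sum.elim_inl, Option.some.injEq] at hc
          exact ⟨a, by rw [hEi, ← hz, hc]⟩
        · simp at hc
      · exact (hE' l hl).2 (y l)
    choose x hx using this
    exact ⟨x, funext hx⟩

/-- `g` does not increase in total under local generalised measurements. -/
theorem ProjSuperadditive.sum_kraus_le (hg : ProjSuperadditive g)
    (hg0 : ∀ a, 0 ≤ g a) {i : Fin k} (hd : ∀ j, j ≠ i → d' j = d j) {J : Type*}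
    (K : J → Matrix (Fin (d' i)) (Fin (d i)) ℂ) (t : Finset J)
    (hK : (1 - ∑ j ∈ t, (K j)ᴴ * K j).PosSemidef) (ψ : PureState d) :
    ∑ j ∈ t, g (S.mk ((localOp i (K j) : Matrix (Idx d') (Idx d) ℂ) *ᵥ ψ)) ≤ g (S.mk ψ) := by
  rw [← Finset.sum_coe_sort] at hK ⊢
  refine hg.sum_kraus_le_of_dilation hg0 (d'' := Function.update d i
    (Fintype.card ((t × Fin (d' i)) ⊕ Fin (d i)))) hd
    (fun j hj => Function.update_of_ne hj _ _) ?_ (fun j : t => K j) hK ψ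
  exact Fintype.equivFinOfCardEq (by simp)

/-- `ρ` is a mixture of pure states, labelled by the register, on which `g` is at most `t` in
total. -/
def HasEnsemble (g : S k → M) {X : Type} (ρ : RegOp d X) (t : M) : Prop :=
  open Classical in
  ∃ (L : Type) (s : Finset L) (r : L → X) (φ : L → PureState d),
    (∀ x, ρ x = ∑ l ∈ s with r l = x, ketbra (φ l)) ∧ ∑ l ∈ s, g (S.mk (φ l)) ≤ t

/-- The member `l` meets only the Kraus operators reading its register value `r l`. Their
normalisation is the block `r l` of `kraus_le`. -/
theorem HasEnsemble.apply_oneStep (hg : ProjSuperadditive g) (hg0 : ∀ a, 0 ≤ g a) {X Y : Type}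
    {ρ : RegOp d X} {t : M} (h : HasEnsemble g ρ t) (c : OneStep d d' X Y) :
    HasEnsemble g (c.apply ρ) t := by
  classical
  obtain ⟨L, s, r, φ, hρ, ht⟩ := h
  refine ⟨L × c.J, (s ×ˢ Finset.univ).filter (fun p => c.f p.2 = r p.1), fun p => c.g p.2,
    fun p => (localOp c.i (c.K p.2) : Matrix (Idx d') (Idx d) ℂ) *ᵥ φ p.1, fun y => ?_, ?_⟩
  · rw [OneStep.apply, Finset.sum_filter, Finset.sum_filter, Finset.sum_filter,
      Finset.sum_product_right]
    refine Finset.sum_congr rfl fun j _ => ?_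
    rw [hρ, Matrix.mul_sum, Matrix.sum_mul, Finset.sum_filter]
    by_cases h1 : c.g j = y
    · simp only [h1, if_true, conj_ketbra, eq_comm]
    · simp [h1]
  · refine le_trans ?_ ht
    rw [Finset.sum_filter, Finset.sum_product]
    refine Finset.sum_le_sum fun l _ => ?_
    rw [← Finset.sum_filter]
    refine hg.sum_kraus_le hg0 c.dims_eq c.K _ ?_ (φ l)
    convert c.kraus_le (r l)

theorem HasEnsemble.of_isLOCC (hg : ProjSuperadditive g) (hg0 : ∀ a, 0 ≤ g a) {X Y : Type}
    {Λ : RegOp d X → RegOp d' Y} (hΛ : IsLOCC Λ) {ρ : RegOp d X} {t : M}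
    (h : HasEnsemble g ρ t) : HasEnsemble g (Λ ρ) t := by
  induction hΛ with
  | id => exact h
  | step _ c ih => exact (ih h).apply_oneStep hg hg0 c

/-- Pure state decompositions of a pure state are trivial. -/
theorem exists_smul_of_ketbra_eq_sum {L : Type*} {φ : PureState d} (hφ : φ ≠ 0) (s : Finset L)
    (χ : L → PureState d) (h : ketbra φ = ∑ l ∈ s, ketbra (χ l)) :
    ∃ c : L → ℂ, (∀ l ∈ s, χ l = c l • φ) ∧ ∑ l ∈ s, ‖c l‖ ^ 2 = 1 := by
  have quad : ∀ v ψ : PureState d, star v ⬝ᵥ (ketbra ψ *ᵥ v) = ((‖star v ⬝ᵥ ψ‖ ^ 2 : ℝ) : ℂ) := by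
    intro v ψ
    rw [ketbra, Matrix.vecMulVec_mulVec, Complex.ofReal_pow, ← Complex.mul_conj']
    have : (starRingEnd ℂ) (star v ⬝ᵥ ψ) = star ψ ⬝ᵥ v := by
      rw [starRingEnd_apply, Matrix.star_dotProduct, star_star]
    rw [this]
    simp [dotProduct_smul, mul_comm]
  -- The form of `|φ⟩⟨φ|` at `v ⊥ φ` is zero and is a sum of nonnegative terms, so each `χ l` is
  -- orthogonal to `v`.
  have orth : ∀ v, star v ⬝ᵥ φ = 0 → ∀ l ∈ s, star v ⬝ᵥ χ l = 0 := by
    intro v hv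
    have h1 := quad v φ
    rw [h, Matrix.sum_mulVec, dotProduct_sum, hv] at h1
    simp only [quad] at h1
    rw [← Complex.ofReal_sum, Complex.ofReal_inj] at h1
    have h2 : ∑ l ∈ s, ‖star v ⬝ᵥ χ l‖ ^ 2 = 0 := by simpa using h1
    intro l hl
    have := (Finset.sum_eq_zero_iff_of_nonneg (fun _ _ => sq_nonneg _)).mp h2 l hl
    simpa using this
  have hne : star φ ⬝ᵥ φ ≠ 0 := by simpa using hφ
  have hc : ∀ l ∈ s, χ l = ((star φ ⬝ᵥ χ l) / (star φ ⬝ᵥ φ)) • φ := by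
    intro l hl
    set c := (star φ ⬝ᵥ χ l) / (star φ ⬝ᵥ φ) with hcdef
    -- The component of `χ l` orthogonal to `φ` is itself an admissible `v`, hence orthogonal to `χ
    -- l` and so to itself.
    have h0 : star φ ⬝ᵥ (χ l - c • φ) = 0 := by
      rw [dotProduct_sub, dotProduct_smul, smul_eq_mul, hcdef, div_mul_cancel₀ _ hne, sub_self]
    have h0' : star (χ l - c • φ) ⬝ᵥ φ = 0 := by
      rw [Matrix.star_dotProduct, h0, star_zero]
    have h1 := orth _ h0' l hl
    have h2 : star (χ l - c • φ) ⬝ᵥ (χ l - c • φ) = 0 := by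
      rw [dotProduct_sub, h1, dotProduct_smul, h0', smul_zero, sub_zero]
    exact sub_eq_zero.mp (dotProduct_star_self_eq_zero.mp h2)
  refine ⟨_, hc, ?_⟩
  have h1 : ketbra φ = ((∑ l ∈ s, ‖(star φ ⬝ᵥ χ l) / (star φ ⬝ᵥ φ)‖ ^ 2 : ℝ) : ℂ) • ketbra φ := by
    rw [Complex.ofReal_sum, Finset.sum_smul]
    refine h.trans (Finset.sum_congr rfl fun l hl => ?_)
    rw [← ketbra_smul, ← hc l hl]
  obtain ⟨x, hx⟩ := Function.ne_iff.mp hφ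
  have h2 := congrFun (congrFun h1 x) x
  have h3 : ketbra φ x x ≠ 0 := by
    simpa [ketbra, Matrix.vecMulVec_apply] using hx
  rw [Matrix.smul_apply, smul_eq_mul] at h2
  have h4 := mul_right_cancel₀ h3 (h2.symm.trans (one_mul _).symm)
  exact_mod_cast h4

/-- If `ψ` converts to `φ ≠ 0`, then `g` is at most `g ψ` in total on some multiples of `φ` whose
squared coefficients sum to one. -/
theorem Converts.exists_sum_smul_le (hg : ProjSuperadditive g) (hg0 : ∀ a, 0 ≤ g a)
    {ψ : PureState d} {φ : PureState d'} (h : Converts ψ φ) (hφ : φ ≠ 0) :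
    ∃ (L : Type) (s : Finset L) (c : L → ℂ), ∑ l ∈ s, ‖c l‖ ^ 2 = 1 ∧
      ∑ l ∈ s, g (S.mk (c l • φ)) ≤ g (S.mk ψ) := by
  obtain ⟨Λ, hΛ, h⟩ := h
  have h0 : HasEnsemble g (fun _ : Unit => ketbra ψ) (g (S.mk ψ)) :=
    ⟨Unit, Finset.univ, id, fun _ => ψ, by simp, by simp⟩
  obtain ⟨L, s, r, χ, h1, h2⟩ := h0.of_isLOCC hg hg0 hΛ
  rw [h] at h1
  obtain ⟨c, hc, hc1⟩ := exists_smul_of_ketbra_eq_sum hφ s χ (by simpa using h1 ())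
  refine ⟨L, s, c, hc1, le_of_eq_of_le (Finset.sum_congr rfl fun l hl => ?_) h2⟩
  rw [hc l hl]

end Superadditive

/-! ### Construction of LOCC channels -/

section Channels

variable {k : ℕ} {d d' : Fin k → ℕ}

theorem sum_filter_eq_self {Y A : Type*} [Fintype Y] [AddCommMonoid A] (y : Y)
    [DecidablePred (fun j => j = y)] (F : Y → A) : ∑ j with j = y, F j = F y := by
  classical
  rw [Finset.sum_filter, Finset.sum_eq_single y]
  · simp
  · intro j _ hj
    simp [hj]
  · simp

/-- Local contractions controlled by the register can be appended to an LOCC channel. -/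
theorem IsLOCC.comp_contractions {X Y : Type} [Finite X] [Finite Y]
    {Λ : RegOp d X → RegOp d' Y} (hΛ : IsLOCC Λ)
    (U : Y → (j : Fin k) → Matrix (Fin (d' j)) (Fin (d' j)) ℂ)
    (hU : ∀ y j, (1 - (U y j)ᴴ * U y j).PosSemidef) :
    IsLOCC (fun ρ y => tensorOp (U y) * Λ ρ y * (tensorOp (U y))ᴴ) := by
  classical
  have := Fintype.ofFinite Y
  -- The parties act in turn; `s` is the set of those that have acted.
  suffices ∀ s : Finset (Fin k), IsLOCC (fun ρ y =>
      tensorOp (fun j => if j ∈ s then U y j else 1) * Λ ρ y *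
        (tensorOp (fun j => if j ∈ s then U y j else 1))ᴴ) by
    simpa using this Finset.univ
  intro s
  induction s using Finset.induction_on with
  | empty => simpa [tensorOp_one] using hΛ
  | insert i s hi ih =>
    convert ih.step (⟨i, fun _ _ => rfl, Y, fun y => y, fun y => y, fun y => U y i, fun y => ?_⟩ :
      OneStep d' d' Y Y) using 1
    · funext ρ y
      have h1 : tensorOp (fun j => if j ∈ insert i s then U y j else 1) =
          (localOp i (U y i) : Matrix (Idx d') (Idx d') ℂ) *
            tensorOp (fun j => if j ∈ s then U y j else 1) := by
        rw [localOp_eq_tensorOp_update, tensorOp_mul]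
        congr 1
        funext j
        by_cases hj : j = i
        · subst hj
          simp [hi]
        · simp [hj]
      simp only [OneStep.apply, sum_filter_eq_self]
      rw [h1, Matrix.conjTranspose_mul]
      simp only [Matrix.mul_assoc]
    · simpa only [sum_filter_eq_self] using hU y i

/-- A local measurement all of whose outcomes have the same class prepares that class. -/
theorem converts_of_kraus {ψ χ : PureState d} {i : Fin k} {J : Type} [Fintype J]
    (K : J → Matrix (Fin (d i)) (Fin (d i)) ℂ) (hK : (1 - ∑ j, (K j)ᴴ * K j).PosSemidef)
    (h : ∀ j, S.mk ((localOp i (K j) : Matrix (Idx d) (Idx d) ℂ) *ᵥ ψ) = S.mk χ) :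
    Converts ψ ((Real.sqrt (Fintype.card J) : ℂ) • χ) := by
  choose U hU hU' using fun j => exists_contractions_of_mk_eq (h j)
  -- Party `i` measures and writes the outcome `j` to the register.
  have h1 := (IsLOCC.id (d := d) (X := Unit)).step
    (⟨i, fun _ _ => rfl, J, fun _ => (), id, K, fun x => by simpa using hK⟩ :
      OneStep d d Unit J)
  -- The corrections `U j` turn every outcome into `χ` itself; forgetting the register then adds up
  -- `Fintype.card J` copies of `ketbra χ`.
  have h2 := (h1.comp_contractions U hU).step
    (⟨i, fun _ _ => rfl, J, id, fun _ => (), fun _ => 1, fun x => by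
      simpa [sum_filter_eq_self, -Finset.sum_const] using
        (Matrix.PosSemidef.zero : (0 : Matrix (Fin (d i)) (Fin (d i)) ℂ).PosSemidef)⟩ : OneStep d d J Unit)
  refine ⟨_, h2, ?_⟩
  funext y
  simp only [OneStep.apply, id, sum_filter_eq_self, localOp_one, conj_ketbra, ← hU', Matrix.one_mulVec, Finset.filter_true]
  rw [Finset.sum_const, ketbra_smul, Finset.card_univ]
  simp [Nat.cast_smul_eq_nsmul]

theorem IsMonotone.map_le_of_contraction {f : S k →+* ℝ≥0} (hf : IsMonotone f) {i : Fin k}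
    (K : Matrix (Fin (d i)) (Fin (d i)) ℂ) (hK : (1 - Kᴴ * K).PosSemidef) (ψ : PureState d) :
    f (S.mk ((localOp i K : Matrix (Idx d) (Idx d) ℂ) *ᵥ ψ)) ≤ f (S.mk ψ) := by
  apply hf
  refine ⟨d, d, _, ψ, rfl, rfl, ?_⟩
  simpa using converts_of_kraus (J := Unit) (fun _ => K) (by simpa using hK) (fun _ => rfl)

end Channels

/-! ### Measurements on many copies -/

section Power

variable {k n : ℕ} {d : Fin k → ℕ}

/-- The tensor product of `n` states with the same local dimensions. -/
def ntprod (ψ : Fin n → PureState d) : PureState (fun j => d j ^ n) := fun x =>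
  ∏ t, ψ t (fun j => finFunctionFinEquiv.symm (x j) t)

theorem mk_ntprod (ψ : Fin n → PureState d) : S.mk (ntprod ψ) = ∏ t, S.mk (ψ t) := by
  induction n with
  | zero =>
    rw [Fin.prod_univ_zero]
    refine sound_equiv (fun j => finCongr (pow_zero _)) _ (scalarState k 1) fun x => ?_
    simp [ntprod, scalarState]
  | succ n ih =>
    rw [Fin.prod_univ_succ, ← ih, mk_mul_mk]
    refine sound_equiv (fun j => finFunctionFinEquiv.symm.trans
      ((Fin.consEquiv (fun _ => Fin (d j))).symm.trans
        (((Equiv.refl _).prodCongr finFunctionFinEquiv).trans finProdFinEquiv))) _ _ fun x => ?_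
    simp only [tprod, ntprod, Equiv.trans_apply, Equiv.symm_apply_apply, Fin.prod_univ_succ]
    simp only [Equiv.prodCongr_apply, Prod.map, Equiv.refl_apply, Equiv.symm_apply_apply]
    rfl

/-- The tensor product of `n` square matrices of the same size. -/
def ntMat {m : ℕ} (A : Fin n → Matrix (Fin m) (Fin m) ℂ) : Matrix (Fin (m ^ n)) (Fin (m ^ n)) ℂ :=
  (tensorOp (d := fun _ => m) (d' := fun _ => m) A).submatrix finFunctionFinEquiv.symm
    finFunctionFinEquiv.symm

theorem ntMat_mul {m : ℕ} (A B : Fin n → Matrix (Fin m) (Fin m) ℂ) :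
    ntMat A * ntMat B = ntMat (fun t => A t * B t) := by
  rw [ntMat, ntMat, ntMat, Matrix.submatrix_mul_equiv, tensorOp_mul]

theorem ntMat_conjTranspose {m : ℕ} (A : Fin n → Matrix (Fin m) (Fin m) ℂ) :
    (ntMat A)ᴴ = ntMat (fun t => (A t)ᴴ) := by
  rw [ntMat, ntMat, Matrix.conjTranspose_submatrix, tensorOp_conjTranspose]

theorem ntMat_one {m : ℕ} : ntMat (fun _ : Fin n => (1 : Matrix (Fin m) (Fin m) ℂ)) = 1 := by
  rw [ntMat, tensorOp_one, Matrix.submatrix_one_equiv]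

/-- The products over copies and over parties commute. -/
theorem tensorOp_ntprod (U : Fin n → (j : Fin k) → Matrix (Fin (d j)) (Fin (d j)) ℂ)
    (ψ : Fin n → PureState d) :
    tensorOp (fun j => ntMat (fun t => U t j)) *ᵥ ntprod ψ =
      ntprod (fun t => tensorOp (U t) *ᵥ ψ t) := by
  funext y
  simp only [Matrix.mulVec, dotProduct, ntprod]
  rw [Finset.prod_univ_sum, Fintype.piFinset_univ,
    ← ((Equiv.piComm (fun (_ : Fin n) j => Fin (d j))).trans
      (Equiv.piCongrRight fun j => finFunctionFinEquiv)).sum_comp]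
  refine Finset.sum_congr rfl fun x _ => ?_
  rw [Finset.prod_mul_distrib]
  simp only [tensorOp, ntMat, Matrix.of_apply, Matrix.submatrix_apply, Equiv.trans_apply,
    Equiv.piCongrRight_apply, Pi.map_apply, Equiv.symm_apply_apply, Equiv.piComm_apply]
  rw [Finset.prod_comm]

theorem localOp_ntprod (i : Fin k) (A : Fin n → Matrix (Fin (d i)) (Fin (d i)) ℂ)
    (ψ : Fin n → PureState d) :
    (localOp (d := fun j => d j ^ n) i (ntMat A) :
        Matrix (Idx (fun j => d j ^ n)) (Idx (fun j => d j ^ n)) ℂ) *ᵥ ntprod ψ =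
      ntprod (fun t => (localOp i (A t) : Matrix (Idx d) (Idx d) ℂ) *ᵥ ψ t) := by
  simp only [localOp_eq_tensorOp_update]
  rw [← tensorOp_ntprod]
  congr 2
  funext j
  by_cases hj : j = i
  · subst hj
    simp
  · simp [hj, ntMat_one]

/-- Expanding `1 = (P + (1 - P))^{⊗n}` writes the identity as a sum of projections indexed by all
sets `s`; the difference is the part over the complement of `T`. -/
theorem posSemidef_one_sub_sum_ntMat {m : ℕ} {P : Matrix (Fin m) (Fin m) ℂ}
    (hP : IsStarProjection P) (T : Finset (Finset (Fin n))) :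
    (1 - ∑ s ∈ T, (ntMat fun t => if t ∈ s then P else 1 - P)ᴴ *
      ntMat fun t => if t ∈ s then P else 1 - P).PosSemidef := by
  classical
  have h1 : ∀ s : Finset (Fin n), (ntMat fun t => if t ∈ s then P else 1 - P)ᴴ *
      (ntMat fun t => if t ∈ s then P else 1 - P) = ntMat fun t => if t ∈ s then P else 1 - P := by
    intro s
    rw [ntMat_conjTranspose, ntMat_mul]
    congr 1
    funext t
    have hQ := hP.one_sub
    split_ifs
    · rw [← Matrix.star_eq_conjTranspose, hP.isSelfAdjoint.star_eq, hP.isIdempotentElem.eq]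
    · rw [← Matrix.star_eq_conjTranspose, hQ.isSelfAdjoint.star_eq, hQ.isIdempotentElem.eq]
  have h2 : ∑ s : Finset (Fin n), (ntMat fun t => if t ∈ s then P else 1 - P) = 1 := by
    rw [← ntMat_one]
    ext y x
    simp only [Matrix.sum_apply, ntMat, Matrix.submatrix_apply, tensorOp, Matrix.of_apply]
    have h3 : ∀ t : Fin n, (1 : Matrix (Fin m) (Fin m) ℂ) = P + (1 - P) := fun t => by abel
    rw [Finset.prod_congr rfl fun t _ => congrFun (congrFun (h3 t) _) _]
    simp only [Matrix.add_apply]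
    rw [Finset.prod_add, Finset.powerset_univ]
    refine Finset.sum_congr rfl fun s _ => ?_
    rw [← Finset.prod_mul_prod_compl s, Finset.compl_eq_univ_sdiff]
    congr 1
    · exact Finset.prod_congr rfl fun t ht => by rw [if_pos ht]
    · exact Finset.prod_congr rfl fun t ht => by rw [if_neg (Finset.mem_sdiff.mp ht).2]
  rw [← h2, ← Finset.sum_add_sum_compl T, Finset.sum_congr rfl fun s _ => h1 s, add_sub_cancel_left]
  refine Matrix.posSemidef_sum _ fun s _ => ?_
  rw [← h1 s]
  exact Matrix.posSemidef_conjTranspose_mul_self _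

/-- The class of an outcome `s` on `n` copies depends only on the number `m` of factors `P`, so
`converts_of_kraus` merges all outcomes with this `m`. -/
theorem IsMonotone.choose_mul_le {f : S k →+* ℝ≥0} (hf : IsMonotone f) (φ : PureState d)
    (i : Fin k) {P : Matrix (Fin (d i)) (Fin (d i)) ℂ} (hP : IsStarProjection P) {n m : ℕ}
    (hm : m ≤ n) :
    f (S.mk (scalarState k (Real.sqrt (n.choose m)))) *
        (f (S.mk ((localOp i P : Matrix (Idx d) (Idx d) ℂ) *ᵥ φ)) ^ m *
        f (S.mk ((localOp i (1 - P) : Matrix (Idx d) (Idx d) ℂ) *ᵥ φ)) ^ (n - m)) ≤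
      f (S.mk φ) ^ n := by
  classical
  let T : Finset (Finset (Fin n)) := Finset.univ.powersetCard m
  let χ : Finset (Fin n) → PureState (fun j => d j ^ n) := fun s =>
    (localOp (d := fun j => d j ^ n) i (ntMat fun t => if t ∈ s then P else 1 - P) :
      Matrix (Idx (fun j => d j ^ n)) (Idx (fun j => d j ^ n)) ℂ) *ᵥ ntprod fun _ => φ
  have hχ : ∀ s ∈ T, S.mk (χ s) = S.mk ((localOp i P : Matrix (Idx d) (Idx d) ℂ) *ᵥ φ) ^ m *
      S.mk ((localOp i (1 - P) : Matrix (Idx d) (Idx d) ℂ) *ᵥ φ) ^ (n - m) := by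
    intro s hs
    have hs' : s.card = m := (Finset.mem_powersetCard.mp hs).2
    have hc : sᶜ.card = n - m := by rw [Finset.card_compl, hs', Fintype.card_fin]
    simp only [χ]
    rw [localOp_ntprod, mk_ntprod, ← Finset.prod_mul_prod_compl s]
    congr 1
    · rw [Finset.prod_congr rfl fun t ht => by rw [if_pos ht], Finset.prod_const, hs']
    · rw [Finset.prod_congr rfl fun t ht => by rw [if_neg (Finset.mem_compl.mp ht)],
        Finset.prod_const, hc]
  obtain ⟨s₀, hs₀⟩ : T.Nonempty := Finset.powersetCard_nonempty.mpr (by simpa using hm)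
  have hconv := converts_of_kraus (ψ := ntprod fun _ : Fin n => φ) (χ := χ s₀) (i := i) (J := T)
    (fun s => ntMat fun t => if t ∈ s.1 then P else 1 - P)
    (by
      have := posSemidef_one_sub_sum_ntMat hP T
      rwa [← Finset.sum_coe_sort] at this)
    (fun s => (hχ s s.2).trans (hχ s₀ hs₀).symm)
  have := hf _ _ ⟨_, _, _, _, rfl, rfl, hconv⟩
  rw [mk_smul, mk_ntprod, hχ s₀ hs₀] at this
  simpa [T] using this

end Power

/-! ### Multiplicative monotone functions and the limit of many copies -/

section Analysis

/-- In logarithmic coordinates `h` is additive and monotone, hence measurable, hence continuous and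
linear; `α` is the slope. -/
theorem exists_eq_rpow_of_monotone (h : ℝ≥0 → ℝ≥0) (hm : Monotone h) (h1 : h 1 = 1)
    (hmul : ∀ p q, h (p * q) = h p * h q) :
    ∃ α : ℝ, 0 ≤ α ∧ ∀ p, 0 < p → h p = p ^ α := by
  have hpos : ∀ p, 0 < p → 0 < h p := by
    intro p hp
    rw [pos_iff_ne_zero]
    intro h0
    have := hmul p p⁻¹
    rw [mul_inv_cancel₀ hp.ne', h1, h0, zero_mul] at this
    exact one_ne_zero this
  have hexp : ∀ t, 0 < (Real.exp t).toNNReal := fun t => Real.toNNReal_pos.mpr (Real.exp_pos t)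
  let A : ℝ →+ ℝ :=
    { toFun := fun t => Real.log (h (Real.exp t).toNNReal)
      map_zero' := by simp [h1]
      map_add' := fun s t => by
        rw [Real.exp_add, Real.toNNReal_mul (Real.exp_pos s).le, hmul, NNReal.coe_mul, Real.log_mul]
        · exact_mod_cast (hpos _ (hexp s)).ne'
        · exact_mod_cast (hpos _ (hexp t)).ne' }
  have hA : Monotone A := fun s t hst => by
    refine Real.log_le_log (by exact_mod_cast hpos _ (hexp s)) ?_
    exact_mod_cast hm (Real.toNNReal_le_toNNReal (Real.exp_le_exp.mpr hst))
  have hcont : Continuous A := MeasureTheory.Measure.AddMonoidHom.continuous_of_measurable A hA.measurable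
  refine ⟨A 1, ?_, fun p hp => ?_⟩
  · rw [← map_zero A]
    exact hA zero_le_one
  · have hp' : (0 : ℝ) < p := hp
    have h2 := map_real_smul A hcont (Real.log p) 1
    simp only [smul_eq_mul, mul_one] at h2
    have h3 : A (Real.log p) = Real.log (h p) := by
      simp [A, Real.exp_log hp']
    rw [h3] at h2
    have h4 : (0 : ℝ) < h p := by exact_mod_cast hpos p hp
    apply NNReal.coe_injective
    rw [NNReal.coe_rpow, Real.rpow_def_of_pos hp', ← h2, Real.exp_log h4]

theorem le_rpow_one_div_iff {α : ℝ} (hα : 0 < α) {x y : ℝ≥0} : x ≤ y ^ (1 / α) ↔ x ^ α ≤ y := by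
  rw [one_div, NNReal.le_rpow_inv_iff hα]

/-- The binomial theorem gives `(A + B) ^ n ≤ (n + 1) * F ^ n`. If `F < A + B`, this fails for large
`n`, as `(n + 1) * r ^ n → 0` for `r = F / (A + B) < 1`. -/
theorem add_le_of_choose_mul_le {A B F : ℝ≥0}
    (h : ∀ n m : ℕ, m ≤ n → (n.choose m : ℝ≥0) * (A ^ m * B ^ (n - m)) ≤ F ^ n) : A + B ≤ F := by
  have hsum : ∀ n : ℕ, (A + B) ^ n ≤ (n + 1) * F ^ n := by
    intro n
    rw [add_pow]
    refine (Finset.sum_le_card_nsmul _ _ (F ^ n) fun m hm => ?_).trans ?_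
    · rw [mul_comm]
      exact h n m (Nat.lt_succ_iff.mp (Finset.mem_range.mp hm))
    · simp
  by_contra! hlt
  have hAB : 0 < (A + B : ℝ≥0) := zero_le.trans_lt hlt
  have hr : |((F / (A + B) : ℝ≥0) : ℝ)| < 1 := by
    rw [NNReal.abs_eq]
    exact_mod_cast (div_lt_one hAB).mpr hlt
  have hlim := (tendsto_self_mul_const_pow_of_abs_lt_one hr).add
    (tendsto_pow_atTop_nhds_zero_of_abs_lt_one hr)
  rw [zero_add] at hlim
  obtain ⟨n, hn⟩ := (hlim.eventually (gt_mem_nhds (zero_lt_one' ℝ))).exists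
  have h1 : (n + 1) * (F / (A + B)) ^ n < 1 := by
    have : ((n + 1 : ℝ≥0) : ℝ) * ((F / (A + B) : ℝ≥0) : ℝ) ^ n < 1 := by
      push_cast at hn ⊢
      linarith
    exact_mod_cast this
  rw [div_pow, ← mul_div_assoc, div_lt_one (pow_pos hAB n)] at h1
  exact absurd (hsum n) h1.not_ge

end Analysis

/-! ### Monotone homomorphisms satisfy the inequality -/

section Monotone

variable {k : ℕ} {d d' : Fin k → ℕ}

theorem mk_scalarState_mul (p q : ℝ≥0) :
    S.mk (scalarState k (Real.sqrt (p * q : ℝ≥0) : ℂ)) =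
      S.mk (scalarState k (Real.sqrt p : ℂ)) * S.mk (scalarState k (Real.sqrt q : ℂ)) := by
  rw [← mk_smul]
  congr 1
  funext x
  simp [scalarState, Real.sqrt_mul]

theorem mk_scalarState_one : S.mk (scalarState k (Real.sqrt (1 : ℝ≥0) : ℂ)) = 1 := by
  simp only [NNReal.coe_one, Real.sqrt_one, Complex.ofReal_one]
  rfl

/-- For `q ≠ 0`, multiplication by `√(p / q)` is a contraction of party `i`. -/
theorem IsMonotone.monotone_scalarState {f : S k →+* ℝ≥0} (hf : IsMonotone f) (i : Fin k) :
    Monotone fun p : ℝ≥0 => f (S.mk (scalarState k (Real.sqrt p : ℂ))) := by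
  intro p q hpq
  rcases eq_or_ne q 0 with rfl | hq
  · rw [le_zero_iff.mp hpq]
  have hr : p / q ≤ 1 := div_le_one_of_le₀ hpq zero_le
  have h1 : star (Real.sqrt (p / q : ℝ≥0) : ℂ) * (Real.sqrt (p / q : ℝ≥0) : ℂ) =
      ((p / q : ℝ≥0) : ℝ) := by
    have : star (Real.sqrt (p / q : ℝ≥0) : ℂ) = (Real.sqrt (p / q : ℝ≥0) : ℂ) :=
      Complex.conj_ofReal _
    rw [this, ← Complex.ofReal_mul, Real.mul_self_sqrt (NNReal.coe_nonneg _)]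
  have := hf.map_le_of_contraction (d := fun _ => 1) (i := i)
    ((Real.sqrt (p / q : ℝ≥0) : ℂ) • (1 : Matrix (Fin 1) (Fin 1) ℂ)) (by
      rw [Matrix.conjTranspose_smul, Matrix.conjTranspose_one, Matrix.smul_mul, Matrix.one_mul,
        smul_smul, h1]
      have h2 : (1 : Matrix (Fin 1) (Fin 1) ℂ) - (((p / q : ℝ≥0) : ℝ) : ℂ) • 1 =
          ((1 - p / q : ℝ≥0) : ℝ) • 1 := by
        rw [NNReal.coe_sub hr]
        ext a b
        simp [Subsingleton.elim a b]
      rw [h2]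
      exact Matrix.PosSemidef.one.smul (NNReal.coe_nonneg _)) (scalarState k (Real.sqrt q : ℂ))
  refine le_of_eq_of_le (congrArg (fun χ => f (S.mk χ)) ?_) this
  funext x
  have h3 : (1 : Matrix (Fin 1) (Fin 1) ℂ) (x i) 0 = 1 := by
    rw [Subsingleton.elim (x i) 0, Matrix.one_apply_eq]
  have h4 : Real.sqrt p = Real.sqrt (p / q : ℝ≥0) * Real.sqrt q := by
    rw [← Real.sqrt_mul (NNReal.coe_nonneg _), ← NNReal.coe_mul, div_mul_cancel₀ _ hq]
  have h5 : (Real.sqrt p : ℂ) = (Real.sqrt (p / q : ℝ≥0) : ℂ) * (Real.sqrt q : ℂ) := by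
    rw [← Complex.ofReal_mul, ← h4]
  simpa [Matrix.mulVec, dotProduct, localOp, scalarState, h3] using h5

theorem star_projection_contraction {m : ℕ} {P : Matrix (Fin m) (Fin m) ℂ}
    (hP : IsStarProjection P) : (1 - Pᴴ * P).PosSemidef := by
  refine contraction_of_partial_isometry P ?_
  rw [← Matrix.star_eq_conjTranspose, hP.isSelfAdjoint.star_eq, hP.isIdempotentElem.eq,
    hP.isIdempotentElem.eq]

theorem IsMonotone.powerMean_le {f : S k →+* ℝ≥0} (hf : IsMonotone f) {α : ℝ} (hα : 0 ≤ α)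
    (hα' : ∀ p : ℝ≥0, 0 < p → f (S.mk (scalarState k (Real.sqrt p : ℂ))) = p ^ α)
    (φ : PureState d) (i : Fin k) (P : Matrix (Fin (d i)) (Fin (d i)) ℂ)
    (hP : IsStarProjection P) :
    powerMean α (f (S.mk ((localOp i P : Matrix (Idx d) (Idx d) ℂ) *ᵥ φ)))
      (f (S.mk ((localOp i (1 - P) : Matrix (Idx d) (Idx d) ℂ) *ᵥ φ))) ≤ f (S.mk φ) := by
  rw [powerMean]
  split_ifs with h0
  · exact max_le (hf.map_le_of_contraction P (star_projection_contraction hP) φ)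
      (hf.map_le_of_contraction (1 - P) (star_projection_contraction hP.one_sub) φ)
  have hpos : 0 < α := lt_of_le_of_ne hα (Ne.symm h0)
  rw [← le_rpow_one_div_iff hpos]
  apply add_le_of_choose_mul_le
  intro n m hm
  have h1 := hf.choose_mul_le φ i hP hm
  have hc : (0 : ℝ≥0) < n.choose m := by exact_mod_cast Nat.choose_pos hm
  have h2 := hα' (n.choose m) hc
  rw [NNReal.coe_natCast] at h2
  rw [h2] at h1
  -- The power `1 / α` turns the factor `(n.choose m) ^ α` into the binomial coefficient.
  have h3 := NNReal.rpow_le_rpow h1 (one_div_nonneg.mpr hα)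
  have hpow : ∀ (x : ℝ≥0) (l : ℕ), (x ^ l) ^ (1 / α) = (x ^ (1 / α)) ^ l := fun x l => by
    rw [← NNReal.rpow_natCast, ← NNReal.rpow_mul, mul_comm, NNReal.rpow_mul, NNReal.rpow_natCast]
  rw [NNReal.mul_rpow, NNReal.mul_rpow, hpow, hpow, hpow, ← NNReal.rpow_mul,
    mul_one_div_cancel h0, NNReal.rpow_one] at h3
  exact h3

/-- On the GHZ vector `1 ⊕ 1`, where `f` is `2`, measuring the label of party `i` leaves two states
of value `1`, so `2 ^ α ≤ 2`. -/
theorem exponent_le_one {f : S k →+* ℝ≥0} (i : Fin k) {α : ℝ}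
    (h : ∀ (d : Fin k → ℕ) (φ : PureState d) (i : Fin k) (P : Matrix (Fin (d i)) (Fin (d i)) ℂ),
      IsStarProjection P →
        powerMean α (f (S.mk ((localOp i P : Matrix (Idx d) (Idx d) ℂ) *ᵥ φ)))
          (f (S.mk ((localOp i (1 - P) : Matrix (Idx d) (Idx d) ℂ) *ᵥ φ))) ≤
        f (S.mk φ)) : α ≤ 1 := by
  by_cases h0 : α = 0
  · rw [h0]
    exact zero_le_one
  let ψ := scalarState k 1
  obtain ⟨P, hP, hP'⟩ := exists_projection_mask (d := fun _ : Fin k => 1 + 1) i {0}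
  have h1 := h _ (dsum ψ ψ) i P hP
  rw [(hP' _).1, (hP' _).2] at h1
  have hcast : ∀ x : Idx (fun _ : Fin k => 1), Fin.castAddEmb 1 (x i) = (0 : Fin (1 + 1)) :=
    fun x => by
      rw [Subsingleton.elim (x i) 0]
      rfl
  have hnat : ∀ x : Idx (fun _ : Fin k => 1), Fin.natAddEmb 1 (x i) ≠ (0 : Fin (1 + 1)) :=
    fun x => by
      rw [Subsingleton.elim (x i) 0]
      exact Fin.ne_of_val_ne one_ne_zero
  have hl0 : ∀ y : Idx (fun _ : Fin k => 1 + 1), y i ≠ 0 →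
      embed (fun _ => Fin.castAddEmb 1) ψ y = 0 := fun y hy => by
    apply embed_apply_of_not
    rintro ⟨x, rfl⟩
    exact hy (hcast x)
  have hr0 : ∀ y : Idx (fun _ : Fin k => 1 + 1), y i = 0 →
      embed (fun _ => Fin.natAddEmb 1) ψ y = 0 := fun y hy => by
    apply embed_apply_of_not
    rintro ⟨x, rfl⟩
    exact hnat x hy
  have hl : mask i {0} (dsum ψ ψ) = embed (fun _ => Fin.castAddEmb 1) ψ := by
    funext y
    by_cases hy : y i = 0
    · simp [mask, hy, dsum, hr0 y hy]
    · simp [mask, hy, hl0 y hy]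
  have hr : mask i {0}ᶜ (dsum ψ ψ) = embed (fun _ => Fin.natAddEmb 1) ψ := by
    funext y
    by_cases hy : y i = 0
    · simp [mask, hy, hr0 y hy]
    · simp [mask, hy, dsum, hl0 y hy]
  rw [hl, hr, ← sound_embed, ← sound_embed, ← mk_add_mk, map_add] at h1
  have h2 : f (S.mk ψ) = 1 := map_one f
  rw [h2, powerMean, if_neg h0, NNReal.one_rpow] at h1
  have h3 : (1 + 1 : ℝ≥0) ^ α ≤ (1 + 1) ^ (1 : ℝ) := by rwa [NNReal.rpow_one]
  by_contra! hlt
  exact absurd (NNReal.rpow_lt_rpow_of_exponent_lt (by norm_num) hlt) h3.not_gt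

end Monotone

/-! ### The inequality implies monotonicity -/

section Converse

variable {k : ℕ} {d d' : Fin k → ℕ}

/-- The nonnegative reals with the maximum as addition. -/
def MaxNNReal : Type := ℝ≥0

noncomputable instance : LinearOrder MaxNNReal := inferInstanceAs (LinearOrder ℝ≥0)

noncomputable instance : Add MaxNNReal := ⟨max⟩

instance : Zero MaxNNReal := ⟨(0 : ℝ≥0)⟩

noncomputable instance : AddCommMonoid MaxNNReal where
  add_assoc := max_assoc
  zero_add := fun a => max_eq_right (zero_le : (0 : ℝ≥0) ≤ a)
  add_zero := fun a => max_eq_left (zero_le : (0 : ℝ≥0) ≤ a)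
  add_comm := max_comm
  nsmul := nsmulRec

instance : IsOrderedAddMonoid MaxNNReal where
  add_le_add_left _ _ h c := max_le_max h (le_refl c)

/-- The condition `c ≠ 0` matters at `α = 0`, where `0 ^ 0 = 1` although `f` vanishes on the zero
vector. -/
theorem map_smul_eq {f : S k →+* ℝ≥0} (i : Fin k) {α : ℝ}
    (hα : ∀ p : ℝ≥0, 0 < p → f (S.mk (scalarState k (Real.sqrt p : ℂ))) = p ^ α) {c : ℂ}
    (hc : c ≠ 0) (φ : PureState d) : f (S.mk (c • φ)) = (‖c‖₊ ^ 2) ^ α * f (S.mk φ) := by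
  rw [mk_smul, map_mul, mk_scalarState_norm i, hα]
  exact pow_pos (nnnorm_pos.mpr hc) 2

theorem map_le_of_converts {f : S k →+* ℝ≥0} {α : ℝ} (hα0 : 0 ≤ α)
    (hα : ∀ p : ℝ≥0, 0 < p → f (S.mk (scalarState k (Real.sqrt p : ℂ))) = p ^ α)
    (h : ∀ (d : Fin k → ℕ) (φ : PureState d) (i : Fin k) (P : Matrix (Fin (d i)) (Fin (d i)) ℂ),
      IsStarProjection P →
        powerMean α (f (S.mk ((localOp i P : Matrix (Idx d) (Idx d) ℂ) *ᵥ φ)))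
          (f (S.mk ((localOp i (1 - P) : Matrix (Idx d) (Idx d) ℂ) *ᵥ φ))) ≤
        f (S.mk φ)) {ψ : PureState d} {φ : PureState d'} (hc : Converts ψ φ) :
    f (S.mk φ) ≤ f (S.mk ψ) := by
  have i : Fin k := ⟨0, pos_of_hom f⟩
  by_cases hφ : φ = 0
  · rw [hφ, ← zero_def, map_zero]
    exact zero_le
  rcases hα0.eq_or_lt with rfl | hpos
  -- At `α = 0` nonzero factors do not change `f`, so a single member with `c l ≠ 0` suffices.
  · let g : S k → MaxNNReal := f
    have hg : ProjSuperadditive g := by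
      intro d φ i P hP
      have := h d φ i P hP
      rw [powerMean, if_pos rfl] at this
      exact this
    have hg0 : ∀ a, 0 ≤ g a := fun a => (zero_le : 0 ≤ f a)
    obtain ⟨L, s, c, hc1, hle⟩ := hc.exists_sum_smul_le hg hg0 hφ
    obtain ⟨l, hl, hcl⟩ : ∃ l ∈ s, c l ≠ 0 := by
      by_contra! hne
      rw [Finset.sum_eq_zero fun l hl => by simp [hne l hl]] at hc1
      exact zero_ne_one hc1
    have h1 := (Finset.single_le_sum (f := fun l => g (S.mk (c l • φ)))
      (fun l _ => hg0 _) hl).trans hle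
    have h2 := map_smul_eq i hα hcl φ
    rw [NNReal.rpow_zero, one_mul] at h2
    rw [← h2]
    exact h1
  -- Here `g (c • φ) = ‖c‖² g φ`, so the weights of the ensemble add up to one.
  · let g : S k → ℝ≥0 := fun a => f a ^ (1 / α)
    have hg : ProjSuperadditive g := by
      intro d φ i P hP
      have := h d φ i P hP
      rwa [powerMean, if_neg hpos.ne', ← le_rpow_one_div_iff hpos] at this
    obtain ⟨L, s, c, hc1, hle⟩ := hc.exists_sum_smul_le hg (fun a => zero_le) hφ
    have h1 : ∀ l, g (S.mk (c l • φ)) = ‖c l‖₊ ^ 2 * g (S.mk φ) := by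
      intro l
      by_cases hcl : c l = 0
      · simp only [hcl, zero_smul, nnnorm_zero, g]
        rw [← zero_def, map_zero, NNReal.zero_rpow (one_div_pos.mpr hpos).ne']
        simp
      · simp only [g]
        rw [map_smul_eq i hα hcl, NNReal.mul_rpow, ← NNReal.rpow_mul,
          mul_one_div_cancel hpos.ne', NNReal.rpow_one]
    have h2 : ∑ l ∈ s, ‖c l‖₊ ^ 2 = 1 := by
      apply NNReal.coe_injective
      push_cast
      exact hc1
    rw [Finset.sum_congr rfl fun l _ => h1 l, ← Finset.sum_mul, h2, one_mul] at hle
    exact (NNReal.rpow_le_rpow_iff (one_div_pos.mpr hpos)).mp hle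

end Converse

end LOCC

/-! ### The characterisation -/

open LOCC in
theorem theorem3 (k : ℕ) (f : S k →+* ℝ≥0) :
    IsMonotone f ↔
      ∃ α : ℝ, α ∈ Set.Icc (0 : ℝ) 1 ∧
        (∀ p : ℝ≥0, 0 < p → f (S.mk (scalarState k (Real.sqrt p : ℂ))) = p ^ α) ∧
        ∀ (d : Fin k → ℕ) (φ : PureState d) (i : Fin k) (P : Matrix (Fin (d i)) (Fin (d i)) ℂ),
          IsStarProjection P →
            powerMean α (f (S.mk ((localOp i P : Matrix (Idx d) (Idx d) ℂ) *ᵥ φ)))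
              (f (S.mk ((localOp i (1 - P) : Matrix (Idx d) (Idx d) ℂ) *ᵥ φ))) ≤
            f (S.mk φ) := by
  constructor
  · intro hf
    have i : Fin k := ⟨0, pos_of_hom f⟩
    obtain ⟨α, hα, hα'⟩ := exists_eq_rpow_of_monotone _ (hf.monotone_scalarState i)
      (by rw [mk_scalarState_one, map_one])
      (fun p q => by rw [mk_scalarState_mul, map_mul])
    have h : ∀ (d : Fin k → ℕ) (φ : PureState d) i P, IsStarProjection P → _ :=
      fun d φ i P hP => hf.powerMean_le hα hα' φ i P hP
    exact ⟨α, ⟨hα, exponent_le_one i h⟩, hα', h⟩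
  · rintro ⟨α, hα, hα', h⟩ a b ⟨d, d', φ, ψ, rfl, rfl, hc⟩
    exact map_le_of_converts hα.1 hα' h hc
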